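/- Let $\mathcal{M}_n$ be the set of complex $n\times n$ matrices and $\mathcal{D}_n\subset\mathcal{M}_n$ the set of density matrices (positive semidefinite, trace $1$). A quantum channel is a linear map $\Phi(X)=\sum_{j=1}^r F_jXF_j^\dagger$ on $\mathcal{M}_n$ with $\sum_j F_j^\dagger F_j=I_n$; it is mixed unitary if the $F_j$ can be chosen to be scalar multiples of unitary matrices, and unital if $\Phi(I_n)=I_n$. For $x,y\in\mathbb{R}^k$ write $x\prec y$ if, for each $m<k$, the sum of the $m$ largest entries of $x$ is at most that of $y$, and the sums of all entries of $x$ and of $y$ are equal. Put $|X|=(X^\dagger X)^{1/2}$. Let $D$ be one of the following functions on $\mathcal{D}_n\times\mathcal{D}_n$: (a) $D(\sigma_1,\sigma_2)=\operatorname{tr}(f(\sigma_1)g(\sigma_2))$ or $D(\sigma_1,\sigma_2)=\operatorname{tr}|f(\sigma_1)g(\sigma_2)|$, where $f(x)=x^p$, $g(x)=x^q$ with $p,q>0$ and $p+q=1$; (b) $D(\sigma_1,\sigma_2)=\operatorname{tr}(f(\sigma_1)g(\sigma_2))$ with $f(x)=x$ and $g(x)=\log x$, under the conventions $0\log 0=0$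 and $x\log 0=-\infty$ for $x>0$ (so $D(\sigma_1,\sigma_2)\in\mathbb{R}\cup\{-\infty\}$, with value $-\infty$ unless $\ker\sigma_2\subseteq\ker\sigma_1$). Let $\mathcal{S}$ be the set of mixed unitary channels or the set of unital channels on $\mathcal{M}_n$. Let $\rho_1,\rho_2\in\mathcal{D}_n$ have eigenvalues (with multiplicity) $a_1\ge\cdots\ge a_n\ge 0$ and $b_1\ge\cdots\ge b_n\ge 0$, respectively. Define $d=(d_1,\dots,d_n)$ by the following algorithm. Step 0. Let $r$ be such that $a_r>0$ and $a_{r+1}=\cdots=a_n=0$. Set $(d_{r+1},\dots,d_n)=(b_{r+1},\dots,b_n)$, and replace $a$ and $b$ by $(a_1,\dots,a_r)$ and $(b_1,\dots,b_r)$. Step 1. Let $k\in\{1,\dots,r\}$ be the largest integer such that $$\frac{1}{a_1+\cdots+a_k}(a_1,\dots,a_k)\prec\frac{1}{b_1+\cdots+b_k}(b_1,\dots,b_k).$$ Step 2. Set $(d_1,\dots,d_k)=\frac{b_1+\cdots+b_k}{a_1+\cdots+a_k}(a_1,\dots,a_k)$. Stop if $k=r$. Otherwise replace $a$ by $(a_{k+1},\dots,a_r)$,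 $b$ by $(b_{k+1},\dots,b_r)$ and $r$ by $r-k$, and repeat Steps 1 and 2 to obtain the next entries of $d$. Then $d_1\ge\cdots\ge d_n$, and $$\max_{\Phi\in\mathcal{S}}D(\rho_1,\Phi(\rho_2))=\sum_{j=1}^n f(a_j)g(d_j).$$ Moreover, the maximum is attained at every $\Phi\in\mathcal{S}$ for which there is a unitary $V$ with $V^\dagger\rho_1V=\operatorname{diag}(a_1,\dots,a_n)$ and $V^\dagger\Phi(\rho_2)V=\operatorname{diag}(d_1,\dots,d_n)$, and such $\Phi\in\mathcal{S}$ exist. -/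

import Mathlib

open scoped Matrix ComplexOrder

noncomputable section

namespace QOpt

/-- Complex `n × n` matrices. -/
abbrev Mat (n : ℕ) := Matrix (Fin n) (Fin n) ℂ

/-- Density matrices: positive semidefinite with trace one. -/
def IsDensity {n : ℕ} (ρ : Mat n) : Prop := ρ.PosSemidef ∧ ρ.trace = 1

/-- `a 0 ≥ a 1 ≥ ⋯` is the list of eigenvalues of `A`, counted with multiplicity. -/
def HasSortedEigenvalues {n : ℕ} (A : Mat n) (a : Fin n → ℝ) : Prop :=
  Antitone a ∧ A.charpoly.roots = Finset.univ.val.map (fun i => (a i : ℂ))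

/-- `F` is a family of Kraus operators of the trace preserving map `Φ`. -/
def IsKraus {n r : ℕ} (Φ : Mat n →ₗ[ℂ] Mat n) (F : Fin r → Mat n) : Prop :=
  (∀ X, Φ X = ∑ j, F j * X * (F j)ᴴ) ∧ ∑ j, (F j)ᴴ * F j = 1

/-- Quantum channels on `Mat n` that fix the identity matrix. -/
def unitalChannels (n : ℕ) : Set (Mat n →ₗ[ℂ] Mat n) :=
  {Φ | (∃ (r : ℕ) (F : Fin r → Mat n), IsKraus Φ F) ∧ Φ 1 = 1}

/-- Quantum channels on `Mat n` with Kraus operators that are multiples of unitary matrices. -/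
def mixedUnitaryChannels (n : ℕ) : Set (Mat n →ₗ[ℂ] Mat n) :=
  {Φ | ∃ (r : ℕ) (F : Fin r → Mat n), IsKraus Φ F ∧
    ∀ j, ∃ (c : ℂ) (U : Mat n), U ∈ Matrix.unitaryGroup (Fin n) ℂ ∧ F j = c • U}

/-- `tr (σ₁ ^ p σ₂ ^ q)`; it is a real number for density matrices. -/
def trPow {n : ℕ} (p q : ℝ) (σ₁ σ₂ : Mat n) : ℝ :=
  (cfc (fun x : ℝ => x ^ p) σ₁ * cfc (fun x : ℝ => x ^ q) σ₂).trace.re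

/-- `tr |X|` with `|X| = (X† X)^(1/2)`. -/
def trAbs {n : ℕ} (X : Mat n) : ℝ := (cfc Real.sqrt (Xᴴ * X)).trace.re

/-- `tr |σ₁ ^ p σ₂ ^ q|`. -/
def trAbsPow {n : ℕ} (p q : ℝ) (σ₁ σ₂ : Mat n) : ℝ :=
  trAbs (cfc (fun x : ℝ => x ^ p) σ₁ * cfc (fun x : ℝ => x ^ q) σ₂)

open scoped Classical in
/-- `tr (σ₁ log σ₂)` under the conventions `0 log 0 = 0` and `x log 0 = -∞` for `x > 0`:
the value is `-∞` unless the kernel of `σ₂` is contained in that of `σ₁`, and in the latter case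
the kernel of `σ₂` contributes nothing (here `Real.log 0 = 0`). -/
def trLog {n : ℕ} (σ₁ σ₂ : Mat n) : EReal :=
  if ∀ v : Fin n → ℂ, σ₂ *ᵥ v = 0 → σ₁ *ᵥ v = 0 then
    (((σ₁ * cfc Real.log σ₂).trace.re : ℝ) : EReal)
  else ⊥

/-- `log x` for `x ≥ 0`, with `log 0 = -∞`; in `EReal` one has `0 * ⊥ = 0` and `x * ⊥ = ⊥`
for `x > 0`. -/
def elog (x : ℝ) : EReal := ENNReal.log (ENNReal.ofReal x)

/-- Sum of the `m` largest entries. -/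
def sumLargest (m : ℕ) (x : List ℝ) : ℝ := ((x.insertionSort (· ≥ ·)).take m).sum

/-- Majorization `x ≺ y` of real vectors of the same length. -/
def Majorized (x y : List ℝ) : Prop :=
  x.length = y.length ∧ (∀ m < x.length, sumLargest m x ≤ sumLargest m y) ∧ x.sum = y.sum

/-- The vector divided by the sum of its entries. -/
def sumNormalize (x : List ℝ) : List ℝ := x.map (fun t => 1 / x.sum * t)

open scoped Classical in
/-- The largest `k ∈ {1, …, r}` (`r` the length of `a`) for which the normalized
`(a₁, …, a_k)` is majorized by the normalized `(b₁, …, b_k)`; it is `0` if there is none. -/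
def blockLength (a b : List ℝ) : ℕ :=
  Nat.findGreatest (fun k => 1 ≤ k ∧ Majorized (sumNormalize (a.take k)) (sumNormalize (b.take k)))
    a.length

open scoped Classical in
theorem blockLength_le (a b : List ℝ) : blockLength a b ≤ a.length := by
  unfold blockLength
  exact Nat.findGreatest_le _

/-- Steps 1 and 2 of the algorithm, repeated until `a` is exhausted. -/
def blocks (a b : List ℝ) : List ℝ :=
  if blockLength a b = 0 then []
  else
    (a.take (blockLength a b)).map
        (fun t => (b.take (blockLength a b)).sum / (a.take (blockLength a b)).sum * t) ++
      blocks (a.drop (blockLength a b)) (b.drop (blockLength a b))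
termination_by a.length
decreasing_by
  have h := blockLength_le a b
  rw [List.length_drop]
  omega

open scoped Classical in
/-- The number `r` of positive entries. -/
def numPos {n : ℕ} (a : Fin n → ℝ) : ℕ := (Finset.univ.filter (fun i => 0 < a i)).card

/-- The output of the whole algorithm as a list: the blocks computed from the first `r` entries,
followed by `(b_{r+1}, …, b_n)`. -/
def outputList {n : ℕ} (a b : Fin n → ℝ) : List ℝ :=
  blocks ((List.ofFn a).take (numPos a)) ((List.ofFn b).take (numPos a)) ++
    (List.ofFn b).drop (numPos a)

/-- The output `(d₁, …, d_n)` of the algorithm. -/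
def output {n : ℕ} (a b : Fin n → ℝ) : Fin n → ℝ := fun i => (outputList a b).getD i 0

/-- Some unitary `V` gives `V† ρ V = diag a` and `V† σ V = diag d`. -/
def SimulDiag {n : ℕ} (ρ σ : Mat n) (a d : Fin n → ℝ) : Prop :=
  ∃ V ∈ Matrix.unitaryGroup (Fin n) ℂ,
    Vᴴ * ρ * V = Matrix.diagonal (fun i => (a i : ℂ)) ∧
    Vᴴ * σ * V = Matrix.diagonal (fun i => (d i : ℂ))

end QOpt

end

/-! ### The algorithm on lists: slopes and partial sums -/

namespace QOpt

/-! Let `c` be the decreasing spectrum of `Φ ρ₂`. A unital channel acts on spectra by a doubly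
stochastic matrix, so the partial sums of `c` are at most those of `b`. The squared moduli of the
overlaps between eigenbases of `ρ₁` and `Φ ρ₂` also form a doubly stochastic matrix, and a
rearrangement inequality bounds the trace functionals by `∑ f(a_i) g(c_i)`. What remains is a
problem about real vectors.

The algorithm solves that problem. With `A_m`, `B_m` the partial sums of `a`, `b`, it builds the
greatest convex minorant of the points `(A_m, B_m)`, `m ≤ r`. Thus `d_i = s_i a_i` with
nondecreasing slopes, and the partial sums of `d` meet those of `b` wherever the slope jumps
(`blocks_spec`, `output_spec`). Since `g` is concave, `f(a_i) g(c_i)` lies below its tangent at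
`d_i`. For the given `f` and `g` the tangent's slope depends on `s_i` alone, namely `q s_i^(-p)` or
`1 / s_i`, and decreases in it. Summation by parts then shows that the first-order terms add up to
at most zero (`IsSlopeFactorization.sum_mul_nonpos`).

For attainment, `d` is majorized by `b`, hence is a convex combination of permutations of `b`; the
same combination of unitary conjugations is a mixed unitary channel
(`exists_mixedUnitary_of_partial_sums_le`). -/

theorem sum_take_eq_sum_range (l : List ℝ) (m : ℕ) :
    (l.take m).sum = ∑ i ∈ Finset.range m, l.getD i 0 := by
  induction l generalizing m with
  | nil => simp
  | cons x l ih =>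
    cases m with
    | zero => simp
    | succ m =>
      rw [Finset.sum_range_succ', List.take_succ_cons, List.sum_cons, ih]
      simp [add_comm]

theorem sumLargest_of_pairwise {x : List ℝ} (hx : x.Pairwise (· ≥ ·)) (m : ℕ) :
    sumLargest m x = (x.take m).sum := by
  rw [sumLargest, hx.insertionSort_eq]

theorem sumLargest_sumNormalize {x : List ℝ} (hx : x.Pairwise (· ≥ ·)) (hs : 0 ≤ x.sum) (m : ℕ) :
    sumLargest m (sumNormalize x) = (x.take m).sum / x.sum := by
  have h : (sumNormalize x).Pairwise (· ≥ ·) := by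
    refine List.Pairwise.map _ (fun s t hst => ?_) hx
    exact mul_le_mul_of_nonneg_left hst (by positivity)
  rw [sumLargest_of_pairwise h, sumNormalize, ← List.map_take, List.sum_map_mul_left, List.map_id']
  ring

/-- Normalization makes both totals `1`, and sortedness turns sums of largest entries into prefix
sums. Clearing denominators leaves a comparison of quotients of partial sums. -/
theorem majorized_sumNormalize_iff {x y : List ℝ} (hlen : x.length = y.length)
    (hx : x.Pairwise (· ≥ ·)) (hy : y.Pairwise (· ≥ ·)) (hxs : 0 < x.sum) (hys : 0 < y.sum) :
    Majorized (sumNormalize x) (sumNormalize y) ↔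
      ∀ m < x.length, (x.take m).sum * y.sum ≤ (y.take m).sum * x.sum := by
  have hsum : ∀ z : List ℝ, 0 < z.sum → (sumNormalize z).sum = 1 := by
    intro z hz
    rw [sumNormalize, List.sum_map_mul_left, List.map_id', one_div, inv_mul_cancel₀ hz.ne']
  have hl : ∀ z : List ℝ, (sumNormalize z).length = z.length := fun z => by simp [sumNormalize]
  simp only [Majorized, hl, hlen, hsum x hxs, hsum y hys, sumLargest_sumNormalize hx hxs.le,
    sumLargest_sumNormalize hy hys.le, div_le_div_iff₀ hxs hys, and_true, true_and]

theorem sum_take_pos {l : List ℝ} (hpos : ∀ x ∈ l, 0 < x) {m : ℕ} (hm : 1 ≤ m)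
    (hl : l ≠ []) : 0 < (l.take m).sum := by
  apply List.sum_pos
  · intro x hx
    exact hpos x (List.mem_of_mem_take hx)
  · simp only [ne_eq, List.take_eq_nil_iff, hl, or_false]
    omega

theorem sum_take_pos_of_pairwise {l : List ℝ} (hl : l.Pairwise (· ≥ ·)) (hnn : ∀ x ∈ l, 0 ≤ x)
    (hs : 0 < l.sum) {m : ℕ} (hm : 1 ≤ m) : 0 < (l.take m).sum := by
  cases l with
  | nil => simp at hs
  | cons x l =>
    obtain ⟨m, rfl⟩ := Nat.exists_eq_add_of_le' hm
    rw [List.take_succ_cons, List.sum_cons]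
    have h1 : 0 ≤ (l.take m).sum :=
      List.sum_nonneg fun y hy => hnn y (List.mem_cons_of_mem _ (List.mem_of_mem_take hy))
    have h2 : 0 < x := by
      by_contra hx
      have h3 : (x :: l).sum ≤ 0 := by
        refine (List.sum_le_card_nsmul (x :: l) 0 fun y hy => ?_).trans (by simp)
        rcases List.mem_cons.1 hy with rfl | hy
        · exact not_lt.1 hx
        · exact (List.rel_of_pairwise_cons hl hy).trans (not_lt.1 hx)
      exact absurd hs (not_lt.2 h3)
    linarith

/-- The block length minimizes the quotient of the partial sums. -/
theorem blockLength_spec {a b : List ℝ} (hlen : a.length = b.length) (hne : a ≠ [])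
    (ha : a.Pairwise (· ≥ ·)) (hapos : ∀ x ∈ a, 0 < x)
    (hb : b.Pairwise (· ≥ ·)) (hbnn : ∀ x ∈ b, 0 ≤ x) (hbs : 0 < b.sum) :
    1 ≤ blockLength a b ∧
    ∀ m ≤ a.length, (b.take (blockLength a b)).sum * (a.take m).sum ≤
      (b.take m).sum * (a.take (blockLength a b)).sum := by
  classical
  have hApos : ∀ m, 1 ≤ m → 0 < (a.take m).sum := fun m hm => sum_take_pos hapos hm hne
  have hBpos : ∀ m, 1 ≤ m → 0 < (b.take m).sum := fun m hm =>
    sum_take_pos_of_pairwise hb hbnn hbs hm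
  have hl1 : 1 ≤ a.length := List.length_pos_of_ne_nil hne
  -- The condition of Step 1 at `k` says that `B_k / A_k ≤ B_m / A_m` for all `1 ≤ m < k`.
  have hP : ∀ k, 1 ≤ k → k ≤ a.length →
      (Majorized (sumNormalize (a.take k)) (sumNormalize (b.take k)) ↔
        ∀ m < k, (a.take m).sum * (b.take k).sum ≤ (b.take m).sum * (a.take k).sum) := by
    intro k hk hka
    rw [majorized_sumNormalize_iff (by simp [hlen]) (ha.sublist (List.take_sublist _ _))
      (hb.sublist (List.take_sublist _ _)) (hApos k hk) (hBpos k hk)]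
    rw [List.length_take, min_eq_left hka]
    refine forall₂_congr fun m hm => ?_
    rw [List.take_take, List.take_take, min_eq_left hm.le]
  set P : ℕ → Prop :=
    fun k => 1 ≤ k ∧ Majorized (sumNormalize (a.take k)) (sumNormalize (b.take k)) with hPdef
  have hP1 : P 1 := by
    refine ⟨le_rfl, (hP 1 le_rfl hl1).2 fun m hm => ?_⟩
    obtain rfl : m = 0 := by omega
    simp
  have hk : blockLength a b = Nat.findGreatest P a.length := by
    unfold blockLength
    congr
  have hspec : P (blockLength a b) := by
    rw [hk]
    exact Nat.findGreatest_spec hl1 hP1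
  have hle := blockLength_le a b
  have hmax : ∀ m ≤ a.length, P m → m ≤ blockLength a b := by
    intro m hm hPm
    rw [hk]
    exact Nat.le_findGreatest hm hPm
  generalize blockLength a b = k at *
  refine ⟨hspec.1, ?_⟩
  have hk1 := hspec.1
  have hkP := (hP k hk1 hle).1 hspec.2
  obtain ⟨m₀, hm₀, hmin⟩ := Finset.exists_min_image (Finset.Icc 1 a.length)
    (fun m => (b.take m).sum / (a.take m).sum) ⟨1, by simp [hl1]⟩
  rw [Finset.mem_Icc] at hm₀
  -- A global minimizer of the quotient satisfies the condition, so it is at most `k`; the condition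
  -- at `k` then shows that `k` is a minimizer too.
  have hm₀P : P m₀ := by
    refine ⟨hm₀.1, (hP m₀ hm₀.1 hm₀.2).2 fun m hm => ?_⟩
    rcases Nat.eq_zero_or_pos m with rfl | hmpos
    · simp
    have := hmin m (Finset.mem_Icc.2 ⟨hmpos, by omega⟩)
    rw [div_le_div_iff₀ (hApos _ hm₀.1) (hApos _ hmpos)] at this
    linarith
  have hm₀k := hmax m₀ hm₀.2 hm₀P
  have hkm₀ : (b.take k).sum / (a.take k).sum ≤ (b.take m₀).sum / (a.take m₀).sum := by
    rw [div_le_div_iff₀ (hApos _ hk1) (hApos _ hm₀.1)]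
    rcases hm₀k.eq_or_lt with rfl | hlt
    · exact le_rfl
    · linarith [hkP m₀ hlt]
  intro m hm
  rcases Nat.eq_zero_or_pos m with rfl | hmpos
  · simp
  have := hkm₀.trans (hmin m (Finset.mem_Icc.2 ⟨hmpos, hm⟩))
  rwa [div_le_div_iff₀ (hApos _ hk1) (hApos _ hmpos)] at this

/-- The blocks multiply `a` by nondecreasing slopes, and the partial sums of the result stay below
those of `b`, with equality wherever the slope jumps. -/
theorem blocks_spec (a b : List ℝ) (hlen : a.length = b.length)
    (ha : a.Pairwise (· ≥ ·)) (hapos : ∀ x ∈ a, 0 < x)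
    (hb : b.Pairwise (· ≥ ·)) (hbnn : ∀ x ∈ b, 0 ≤ x) (hbs : a ≠ [] → 0 < b.sum) :
    (blocks a b).length = a.length ∧ (blocks a b).sum = b.sum ∧
    (∀ m, ((blocks a b).take m).sum ≤ (b.take m).sum) ∧
    ∃ s : ℕ → ℝ, (∀ i < a.length, 0 < s i) ∧
      (∀ i j, i ≤ j → j < a.length → s i ≤ s j) ∧
      (∀ i < a.length, (blocks a b).getD i 0 = s i * a.getD i 0) ∧
      (∀ i, i + 1 < a.length →
        s i = s (i + 1) ∨ ((blocks a b).take (i + 1)).sum = (b.take (i + 1)).sum) ∧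
      (∀ t, (∀ m ≤ a.length, t * (a.take m).sum ≤ (b.take m).sum) → ∀ i < a.length, t ≤ s i) := by
  induction hn : a.length using Nat.strong_induction_on generalizing a b with
  | _ n ih =>
  subst hn
  by_cases hne : a = []
  · subst hne
    have hb0 : b = [] := List.length_eq_zero_iff.1 hlen.symm
    subst hb0
    have h0 : blocks [] [] = [] := by
      rw [blocks, if_pos]
      have := blockLength_le [] []
      simpa using this
    rw [h0]
    exact ⟨rfl, rfl, fun m => by simp, fun _ => 1, by simp⟩
  obtain ⟨hk1, hmin⟩ := blockLength_spec hlen hne ha hapos hb hbnn (hbs hne)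
  have hkle := blockLength_le a b
  have hdef : blocks a b = (a.take (blockLength a b)).map
        (fun t => (b.take (blockLength a b)).sum / (a.take (blockLength a b)).sum * t) ++
      blocks (a.drop (blockLength a b)) (b.drop (blockLength a b)) := by
    rw [blocks, if_neg (by omega)]
  generalize blockLength a b = k at *
  have hA : 0 < (a.take k).sum := sum_take_pos hapos hk1 hne
  have hB : 0 < (b.take k).sum := sum_take_pos_of_pairwise hb hbnn (hbs hne) hk1
  set σ := (b.take k).sum / (a.take k).sum with hσ
  have hσpos : 0 < σ := div_pos hB hA
  have hσA : σ * (a.take k).sum = (b.take k).sum := div_mul_cancel₀ _ hA.ne'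
  have hσle : ∀ m ≤ a.length, σ * (a.take m).sum ≤ (b.take m).sum := by
    intro m hm
    rw [hσ, div_mul_eq_mul_div, div_le_iff₀ hA]
    exact hmin m hm
  have hsplit : ∀ (l : List ℝ) m, (l.take (k + m)).sum = (l.take k).sum + ((l.drop k).take m).sum := by
    intro l m
    rw [List.take_add, List.sum_append]
  have hdlen : (a.drop k).length = a.length - k := List.length_drop
  have htot : (b.drop k).sum + (b.take k).sum = b.sum := by
    rw [add_comm, ← List.sum_append, List.take_append_drop]
  obtain ⟨e1, e2, e3, s', p1, p2, p3, p4, p5⟩ := ih (a.drop k).length (by omega) (a.drop k) (b.drop k)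
    (by simp [hlen]) (ha.sublist (List.drop_sublist _ _)) (fun x hx => hapos x (List.mem_of_mem_drop hx))
    (hb.sublist (List.drop_sublist _ _)) (fun x hx => hbnn x (List.mem_of_mem_drop hx))
    (by
      intro hd
      have h1 := hσle a.length le_rfl
      rw [List.take_length, hlen, List.take_length] at h1
      have h2 : 0 < (a.drop k).sum :=
        List.sum_pos _ (fun x hx => hapos x (List.mem_of_mem_drop hx)) hd
      have h3 : (a.take k).sum + (a.drop k).sum = a.sum := by
        rw [← List.sum_append, List.take_append_drop]
      have h4 : 0 < σ * (a.drop k).sum := mul_pos hσpos h2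
      rw [← h3, mul_add, hσA] at h1
      linarith) rfl
  -- This is what the last clause of the statement is carried for: minimality of `σ`, shifted past
  -- the first block, makes the slopes monotone across the block boundary.
  have hσs : ∀ i < (a.drop k).length, σ ≤ s' i := by
    refine p5 σ fun m hm => ?_
    have h1 := hσle (k + m) (by omega)
    rw [hsplit, hsplit, mul_add, hσA] at h1
    linarith
  have htk : (a.take k).length = k := by simp [hkle]
  have hpre : ∀ m ≤ k, ((blocks a b).take m).sum = σ * (a.take m).sum := by
    intro m hm
    rw [hdef, List.take_append_of_le_length (by simp [hkle, hm]), ← List.map_take, List.take_take,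
      min_eq_left hm, List.sum_map_mul_left, List.map_id']
  have hpost : ∀ m, ((blocks a b).take (k + m)).sum =
      (b.take k).sum + ((blocks (a.drop k) (b.drop k)).take m).sum := by
    intro m
    rw [hdef, List.take_append, List.sum_append, List.length_map, htk, Nat.add_sub_cancel_left,
      List.take_of_length_le (by simp), List.sum_map_mul_left, List.map_id', hσA]
  refine ⟨?_, ?_, ?_, fun i => if i < k then σ else s' (i - k), ?_, ?_, ?_, ?_, ?_⟩
  · rw [hdef, List.length_append, List.length_map, htk, e1]
    omega
  · rw [hdef, List.sum_append, List.sum_map_mul_left, List.map_id', hσA, e2]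
    linarith
  · intro m
    rcases le_total m k with hm | hm
    · rw [hpre m hm]
      exact hσle m (hm.trans hkle)
    · obtain ⟨m, rfl⟩ := Nat.exists_eq_add_of_le hm
      rw [hpost, hsplit]
      linarith [e3 m]
  · intro i hi
    dsimp only
    split_ifs with h
    · exact hσpos
    · exact p1 _ (by omega)
  · intro i j hij hj
    dsimp only
    split_ifs with h1 h2 h2
    · exact le_rfl
    · exact hσs _ (by omega)
    · omega
    · exact p2 _ _ (by omega) (by omega)
  · intro i hi
    dsimp only
    split_ifs with h
    · rw [hdef, List.getD_append _ _ _ _ (by simp; omega), List.getD_eq_getElem _ _ (by simp; omega),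
        List.getD_eq_getElem _ _ hi]
      simp
    · obtain ⟨j, rfl⟩ := Nat.exists_eq_add_of_le (not_lt.1 h)
      rw [hdef, List.getD_append_right _ _ _ _ (by simp), List.length_map, htk,
        Nat.add_sub_cancel_left, p3 j (by omega)]
      congr 1
      simp [List.getD_eq_getElem?_getD]
  · intro i hi
    dsimp only
    -- Inside the first block the slope is constant, at its end the partial sums agree, and beyond
    -- it the recursive statement applies.
    rcases lt_trichotomy (i + 1) k with h | h | h
    · left
      rw [if_pos (by omega), if_pos h]
    · right
      rw [h, hpre k le_rfl, hσA]
    · obtain ⟨j, rfl⟩ := Nat.exists_eq_add_of_le (Nat.le_of_lt_succ h)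
      rw [if_neg (by omega), if_neg (by omega), Nat.add_assoc, Nat.add_sub_cancel_left,
        Nat.add_sub_cancel_left, hpost, hsplit]
      rcases p4 j (by omega) with h | h
      · exact Or.inl h
      · exact Or.inr (by rw [h])
  · intro t ht i hi
    have htσ : t ≤ σ := by
      rw [hσ, le_div_iff₀ hA]
      exact ht k hkle
    dsimp only
    split_ifs with h
    · exact htσ
    · exact htσ.trans (hσs _ (by omega))

end QOpt

/-! ### The output vector as a slope factorization -/

namespace QOpt

/-- Extension of a finite sequence by zero. -/
def extendZero {n : ℕ} (x : Fin n → ℝ) (i : ℕ) : ℝ := (List.ofFn x).getD i 0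

theorem extendZero_coe {n : ℕ} (x : Fin n → ℝ) (i : Fin n) : extendZero x i = x i := by
  simp [extendZero]

theorem extendZero_of_lt {n : ℕ} (x : Fin n → ℝ) {i : ℕ} (h : i < n) :
    extendZero x i = x ⟨i, h⟩ :=
  extendZero_coe x ⟨i, h⟩

theorem sum_range_extendZero {n : ℕ} (x : Fin n → ℝ) {m : ℕ} (hm : m ≤ n) :
    ∑ i ∈ Finset.range m, extendZero x i = ∑ i : Fin n, if i.val < m then x i else 0 := by
  have h1 : ∀ i : Fin n, (if i.val < m then x i else 0) =
      (fun j : ℕ => if j < m then extendZero x j else 0) i := by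
    intro i
    simp only [extendZero_coe]
  rw [Finset.sum_congr rfl fun i _ => h1 i,
    Fin.sum_univ_eq_sum_range (fun j : ℕ => if j < m then extendZero x j else 0) n,
    ← Finset.sum_filter]
  congr 1
  ext i
  simp only [Finset.mem_range, Finset.mem_filter]
  omega

theorem lt_numPos_iff {n : ℕ} {a : Fin n → ℝ} (ha : Antitone a) (i : Fin n) :
    i.val < numPos a ↔ 0 < a i := by
  classical
  have hnum : numPos a = (Finset.univ.filter (fun i => 0 < a i)).card := by
    unfold numPos
    congr
  rw [hnum]
  constructor
  · intro h
    by_contra hi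
    have hsub : (Finset.univ.filter (fun i => 0 < a i)) ⊆ Finset.Iio i := by
      intro j hj
      rw [Finset.mem_filter] at hj
      rw [Finset.mem_Iio]
      by_contra hij
      exact hi (hj.2.trans_le (ha (not_lt.1 hij)))
    have := Finset.card_le_card hsub
    rw [Fin.card_Iio] at this
    omega
  · intro h
    have hsub : Finset.Iic i ⊆ (Finset.univ.filter (fun i => 0 < a i)) := by
      intro j hj
      rw [Finset.mem_filter]
      exact ⟨Finset.mem_univ _, h.trans_le (ha (Finset.mem_Iic.1 hj))⟩
    have := Finset.card_le_card hsub
    rw [Fin.card_Iic] at this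
    omega

theorem numPos_le {n : ℕ} (a : Fin n → ℝ) : numPos a ≤ n := by
  classical
  unfold numPos
  exact (Finset.card_le_univ _).trans (by simp)

/-- The sequence `d` is obtained from the first `r` terms of `a` by multiplication with
nondecreasing slopes `s`; its partial sums stay below those of `b`, with equality wherever the
slope jumps and from `r` on. -/
structure IsSlopeFactorization (r : ℕ) (a b d s : ℕ → ℝ) : Prop where
  slope_pos : ∀ i < r, 0 < s i
  slope_mono : ∀ i j, i ≤ j → j < r → s i ≤ s j
  eq_mul : ∀ i < r, d i = s i * a i
  eq_tail : ∀ i, r ≤ i → d i = b i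
  sum_le : ∀ m, ∑ i ∈ Finset.range m, d i ≤ ∑ i ∈ Finset.range m, b i
  sum_eq : ∑ i ∈ Finset.range r, d i = ∑ i ∈ Finset.range r, b i
  slope_eq_or_sum_eq : ∀ i, i + 1 < r → s i = s (i + 1) ∨
    ∑ i ∈ Finset.range (i + 1), d i = ∑ i ∈ Finset.range (i + 1), b i

theorem output_spec {n : ℕ} {a b : Fin n → ℝ} (ha : Antitone a) (hb : Antitone b)
    (hb0 : ∀ i, 0 ≤ b i) (hbs : 0 < ∑ i, b i) :
    ∃ s, IsSlopeFactorization (numPos a) (extendZero a) (extendZero b)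
      (extendZero (output a b)) s := by
  set r := numPos a with hr
  have hrn : r ≤ n := numPos_le a
  have hpw : ∀ {x : Fin n → ℝ}, Antitone x → (List.ofFn x).Pairwise (· ≥ ·) := by
    intro x hx
    rw [List.pairwise_ofFn]
    exact fun i j hij => hx hij.le
  have hla : ((List.ofFn a).take r).length = r := by simp [hrn]
  have hbnn : ∀ x ∈ List.ofFn b, 0 ≤ x := by
    intro x hx
    obtain ⟨i, rfl⟩ := List.mem_ofFn.1 hx
    exact hb0 i
  obtain ⟨e1, e2, e3, s, p1, p2, p3, p4, -⟩ := blocks_spec ((List.ofFn a).take r) ((List.ofFn b).take r)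
    (by simp) ((hpw ha).sublist (List.take_sublist _ _))
    (by
      intro x hx
      obtain ⟨i, hi, rfl⟩ := List.mem_take_iff_getElem.1 hx
      rw [List.getElem_ofFn]
      exact (lt_numPos_iff ha _).1 (lt_of_lt_of_le hi (min_le_left _ _)))
    ((hpw hb).sublist (List.take_sublist _ _)) (fun x hx => hbnn x (List.mem_of_mem_take hx))
    (by
      intro h
      refine sum_take_pos_of_pairwise (hpw hb) hbnn (by rwa [List.sum_ofFn]) ?_
      by_contra h0
      obtain h0 : r = 0 := by omega
      exact h (by rw [h0, List.take_zero]))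
  rw [hla] at e1 p1 p2 p3 p4
  have hout : List.ofFn (output a b) = outputList a b := by
    apply List.ext_getElem
    · rw [outputList, List.length_append, ← hr, e1]
      simp
      omega
    · intro i h1 h2
      rw [List.getElem_ofFn]
      simp only [output]
      rw [List.getD_eq_getElem _ _ h2]
  have hext : extendZero (output a b) = fun i => (outputList a b).getD i 0 := by
    funext i
    rw [extendZero, hout]
  have hsum : ∀ m, ∑ i ∈ Finset.range m, extendZero (output a b) i = ((outputList a b).take m).sum := by
    intro m
    rw [hext, sum_take_eq_sum_range]
  have hsumb : ∀ m, ∑ i ∈ Finset.range m, extendZero b i = ((List.ofFn b).take m).sum := by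
    intro m
    rw [sum_take_eq_sum_range]
    rfl
  have hpre : ∀ m ≤ r, ((outputList a b).take m).sum =
      ((blocks ((List.ofFn a).take r) ((List.ofFn b).take r)).take m).sum := by
    intro m hm
    rw [outputList, List.take_append_of_le_length (by rw [← hr, e1]; exact hm)]
  have hpreb : ∀ m ≤ r, (((List.ofFn b).take r).take m).sum = ((List.ofFn b).take m).sum := by
    intro m hm
    rw [List.take_take, min_eq_left hm]
  refine ⟨s, p1, p2, ?_, ?_, ?_, ?_, ?_⟩
  · intro i hi
    rw [hext]
    dsimp only
    rw [outputList, List.getD_append _ _ _ _ (by rw [← hr, e1]; exact hi), ← hr, p3 i hi]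
    congr 1
    simp [List.getD_eq_getElem?_getD, extendZero, hi]
  · intro i hi
    rw [hext]
    dsimp only
    rw [outputList, List.getD_append_right _ _ _ _ (by rw [← hr, e1]; exact hi), ← hr, e1, extendZero]
    simp only [List.getD_eq_getElem?_getD, List.getElem?_drop]
    rw [Nat.add_sub_cancel' hi]
  · intro m
    rw [hsum, hsumb]
    rcases le_total m r with hm | hm
    · rw [hpre m hm, ← hpreb m hm]
      exact e3 m
    · obtain ⟨m, rfl⟩ := Nat.exists_eq_add_of_le hm
      rw [outputList, List.take_append, ← hr, e1, Nat.add_sub_cancel_left, List.sum_append,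
        List.take_of_length_le (by omega), e2, List.take_add, List.sum_append]
  · rw [hsum, hsumb, hpre r le_rfl, List.take_of_length_le (by omega), e2]
  · intro i hi
    rw [hsum, hsumb, hpre _ hi.le, ← hpreb _ hi.le]
    exact p4 i hi

/-- Where the slope is constant, `d` inherits its order from `a`. Where the partial sums of `d` and
`b` meet, the inequalities on either side give `d_{i+1} ≤ b_{i+1} ≤ b_i ≤ d_i`. -/
theorem antitone_output {n : ℕ} {a b : Fin n → ℝ} (ha : Antitone a) (hb : Antitone b)
    (hb0 : ∀ i, 0 ≤ b i) (hbs : 0 < ∑ i, b i) : Antitone (output a b) := by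
  obtain ⟨s, hs⟩ := output_spec ha hb hb0 hbs
  have step : ∀ i : ℕ, i + 1 < n → extendZero (output a b) (i + 1) ≤ extendZero (output a b) i := by
    intro i hi
    have hbi : extendZero b (i + 1) ≤ extendZero b i := by
      rw [extendZero_of_lt b hi, extendZero_of_lt b (by omega : i < n)]
      exact hb (Fin.mk_le_mk.2 (by omega))
    have key : ∑ i ∈ Finset.range (i + 1), extendZero (output a b) i =
        ∑ i ∈ Finset.range (i + 1), extendZero b i →
        extendZero (output a b) (i + 1) ≤ extendZero (output a b) i := by
      intro h
      have h1 := hs.sum_le i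
      have h2 := hs.sum_le (i + 1 + 1)
      rw [Finset.sum_range_succ, Finset.sum_range_succ _ (i + 1), h] at h2
      rw [Finset.sum_range_succ, Finset.sum_range_succ] at h
      linarith
    rcases lt_trichotomy (i + 1) (numPos a) with h | h | h
    · rcases hs.slope_eq_or_sum_eq i h with he | he
      · rw [hs.eq_mul i (by omega), hs.eq_mul (i + 1) h, he]
        refine mul_le_mul_of_nonneg_left ?_ (hs.slope_pos _ h).le
        rw [extendZero_of_lt a hi, extendZero_of_lt a (by omega : i < n)]
        exact ha (Fin.mk_le_mk.2 (by omega))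
      · exact key he
    · exact key (h ▸ hs.sum_eq)
    · rw [hs.eq_tail i (by omega), hs.eq_tail (i + 1) (by omega)]
      exact hbi
  have hle : ∀ i j : ℕ, i ≤ j → j < n → extendZero (output a b) j ≤ extendZero (output a b) i := by
    intro i j hij
    induction j, hij using Nat.le_induction with
    | base => exact fun _ => le_rfl
    | succ j hij ih => exact fun hj => (step j hj).trans (ih (by omega))
  intro i j hij
  rw [← extendZero_coe (output a b) i, ← extendZero_coe (output a b) j]
  exact hle i j hij j.2

/-! ### Rearrangement inequalities for substochastic matrices -/

/-- Summation by parts. -/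
theorem sum_mul_le_last_mul_sum (w x : ℕ → ℝ) (r : ℕ)
    (h : ∀ i < r, (w i - w (i + 1)) * ∑ j ∈ Finset.range (i + 1), x j ≤ 0) :
    ∑ i ∈ Finset.range (r + 1), w i * x i ≤ w r * ∑ i ∈ Finset.range (r + 1), x i := by
  induction r with
  | zero => simp
  | succ r ih =>
    rw [Finset.sum_range_succ, Finset.sum_range_succ _ (r + 1)]
    have h1 := ih fun i hi => h i (by omega)
    have h2 := h r (by omega)
    linarith

theorem sum_mul_nonpos_of_antitone {n : ℕ} {w x : Fin n → ℝ} (hw : Antitone w)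
    (hx : ∀ m ≤ n, (∑ i : Fin n, if i.val < m then x i else 0) ≤ 0)
    (h : (∀ i, 0 ≤ w i) ∨ ∑ i, x i = 0) : ∑ i, w i * x i ≤ 0 := by
  cases n with
  | zero => simp
  | succ n =>
    have e : ∑ i, w i * x i = ∑ i ∈ Finset.range (n + 1), extendZero w i * extendZero x i := by
      rw [← Fin.sum_univ_eq_sum_range (fun i => extendZero w i * extendZero x i)]
      simp only [extendZero_coe]
    rw [e]
    refine (sum_mul_le_last_mul_sum _ _ n fun i hi => ?_).trans ?_
    · rw [sum_range_extendZero x (by omega)]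
      refine mul_nonpos_of_nonneg_of_nonpos ?_ (hx _ (by omega))
      rw [extendZero_of_lt w (by omega : i < n + 1), extendZero_of_lt w (by omega : i + 1 < n + 1),
        sub_nonneg]
      exact hw (Fin.mk_le_mk.2 (by omega))
    · rcases h with h | h
      · rw [sum_range_extendZero x le_rfl, extendZero_of_lt w (by omega : n < n + 1)]
        exact mul_nonpos_of_nonneg_of_nonpos (h _) (hx _ le_rfl)
      · have : ∑ i ∈ Finset.range (n + 1), extendZero x i = 0 := by
          rw [sum_range_extendZero x le_rfl, ← h]
          exact Finset.sum_congr rfl fun i _ => if_pos i.2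
        rw [this, mul_zero]

/-- Weights in `[0, 1]` of total mass at most `m` do best when concentrated on the `m` largest
entries. -/
theorem sum_mul_le_sum_first {n : ℕ} {t y : Fin n → ℝ} (hy : Antitone y) (ht0 : ∀ j, 0 ≤ t j)
    (ht1 : ∀ j, t j ≤ 1) {m : ℕ} (hm : m ≤ n) (hts : ∑ j, t j ≤ m)
    (h : (∀ j, 0 ≤ y j) ∨ ∑ j, t j = m) :
    ∑ j, t j * y j ≤ ∑ j : Fin n, if j.val < m then y j else 0 := by
  cases n with
  | zero => simp
  | succ n =>
    obtain ⟨l, hl1, hl2⟩ : ∃ l : Fin (n + 1), (∀ j : Fin (n + 1), j.val < m → y l ≤ y j) ∧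
        ∀ j : Fin (n + 1), m ≤ j.val → y j ≤ y l := by
      rcases hm.lt_or_eq with hlt | rfl
      · exact ⟨⟨m, hlt⟩, fun j hj => hy (Fin.le_def.2 hj.le), fun j hj => hy (Fin.le_def.2 hj)⟩
      · exact ⟨Fin.last n, fun j _ => hy (Fin.le_last j), fun j hj => absurd j.2 (not_lt.2 hj)⟩
    have hone : (∑ j : Fin (n + 1), if j.val < m then (1 : ℝ) else 0) = m := by
      rw [Fin.sum_univ_eq_sum_range (fun j : ℕ => if j < m then (1 : ℝ) else 0), ← Finset.sum_filter]
      rw [show (Finset.range (n + 1)).filter (· < m) = Finset.range m by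
        ext i; simp only [Finset.mem_filter, Finset.mem_range]; omega]
      simp
    have hL : 0 ≤ y l * (m - ∑ j, t j) := by
      rcases h with h | h
      · exact mul_nonneg (h l) (sub_nonneg.2 hts)
      · rw [h, sub_self, mul_zero]
    -- With `1_{j<m}` the indicator and `y l` the threshold, this is `(1_{j<m} - t j) * (y j - y l)
    -- ≥ 0`.
    have hterm : ∀ j : Fin (n + 1),
        t j * y j + y l * ((if j.val < m then (1 : ℝ) else 0) - t j) ≤
          if j.val < m then y j else 0 := by
      intro j
      split_ifs with hj
      · nlinarith [hl1 j hj, ht1 j]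
      · nlinarith [hl2 j (not_lt.1 hj), ht0 j]
    have := Finset.sum_le_sum fun j (_ : j ∈ Finset.univ) => hterm j
    rw [Finset.sum_add_distrib, ← Finset.mul_sum, Finset.sum_sub_distrib, hone] at this
    linarith

/-- Nonnegative matrices with row sums and column sums at most one. -/
structure IsSubstochastic {n : ℕ} (S : Fin n → Fin n → ℝ) : Prop where
  nonneg : ∀ i j, 0 ≤ S i j
  row_le : ∀ i, ∑ j, S i j ≤ 1
  col_le : ∀ j, ∑ i, S i j ≤ 1

theorem IsSubstochastic.partial_sum_le {n : ℕ} {S : Fin n → Fin n → ℝ} (hS : IsSubstochastic S)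
    {y : Fin n → ℝ} (hy : Antitone y) (h : (∀ j, 0 ≤ y j) ∨ ∀ i, ∑ j, S i j = 1)
    {m : ℕ} (hm : m ≤ n) :
    (∑ i : Fin n, if i.val < m then ∑ j, S i j * y j else 0) ≤
      ∑ j : Fin n, if j.val < m then y j else 0 := by
  have hone : (∑ j : Fin n, if j.val < m then (1 : ℝ) else 0) = m := by
    rw [Fin.sum_univ_eq_sum_range (fun j : ℕ => if j < m then (1 : ℝ) else 0), ← Finset.sum_filter]
    rw [show (Finset.range n).filter (· < m) = Finset.range m by
      ext i; simp only [Finset.mem_filter, Finset.mem_range]; omega]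
    simp
  have e : (∑ i : Fin n, if i.val < m then ∑ j, S i j * y j else 0) =
      ∑ j, (∑ i : Fin n, if i.val < m then S i j else 0) * y j := by
    simp_rw [Finset.sum_mul]
    rw [Finset.sum_comm]
    refine Finset.sum_congr rfl fun i _ => ?_
    split_ifs
    · rfl
    · simp
  have et : ∑ j, (∑ i : Fin n, if i.val < m then S i j else 0) =
      ∑ i : Fin n, if i.val < m then ∑ j, S i j else 0 := by
    rw [Finset.sum_comm]
    refine Finset.sum_congr rfl fun i _ => ?_
    split_ifs
    · rfl
    · simp
  rw [e]
  refine sum_mul_le_sum_first hy (fun j => ?_) (fun j => ?_) hm ?_ ?_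
  · refine Finset.sum_nonneg fun i _ => ?_
    split_ifs
    · exact hS.nonneg i j
    · exact le_rfl
  · refine (Finset.sum_le_sum fun i _ => ?_).trans (hS.col_le j)
    split_ifs
    · exact le_rfl
    · exact hS.nonneg i j
  · rw [et, ← hone]
    refine Finset.sum_le_sum fun i _ => ?_
    split_ifs
    · exact hS.row_le i
    · exact le_rfl
  · refine h.imp id fun h => ?_
    rw [et, ← hone]
    simp only [h]

/-- The vector `S y` has smaller partial sums than `y`; summation by parts against `x` finishes.
Nonnegative data serve the powers and the trace norm; exact row and column sums serve the logarithm,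
which changes sign. -/
theorem IsSubstochastic.sum_le {n : ℕ} {S : Fin n → Fin n → ℝ} (hS : IsSubstochastic S)
    {x y : Fin n → ℝ} (hx : Antitone x) (hy : Antitone y)
    (h : ((∀ j, 0 ≤ x j) ∧ ∀ j, 0 ≤ y j) ∨ ((∀ i, ∑ j, S i j = 1) ∧ ∀ j, ∑ i, S i j = 1)) :
    ∑ i, ∑ j, x i * y j * S i j ≤ ∑ i, x i * y i := by
  have hd : ∑ i, x i * ((∑ j, S i j * y j) - y i) ≤ 0 := by
    refine sum_mul_nonpos_of_antitone hx (fun m hm => ?_) (h.imp And.left fun h => ?_)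
    · have := hS.partial_sum_le hy (h.imp And.right And.left) hm
      rw [← sub_nonpos, ← Finset.sum_sub_distrib] at this
      refine le_of_eq_of_le (Finset.sum_congr rfl fun i _ => ?_) this
      split_ifs
      · rfl
      · simp
    · rw [Finset.sum_sub_distrib, Finset.sum_comm]
      simp_rw [← Finset.sum_mul, h.2, one_mul, sub_self]
  simp_rw [mul_sub, Finset.sum_sub_distrib, Finset.mul_sum] at hd
  refine le_trans (le_of_eq ?_) (sub_nonpos.1 hd)
  exact Finset.sum_congr rfl fun i _ => Finset.sum_congr rfl fun j _ => by ring

/-! ### Optimality of the output among admissible spectra -/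

/-- In the summation by parts, the term at `i` vanishes if the slope does not change there. At a
jump the partial sum of `d` equals that of `b` and so dominates that of `c`, while `φ` does not
increase. -/
theorem IsSlopeFactorization.sum_mul_nonpos {r : ℕ} {a b d s : ℕ → ℝ}
    (hs : IsSlopeFactorization r a b d s) {c : ℕ → ℝ}
    (hc : ∀ m ≤ r, ∑ i ∈ Finset.range m, c i ≤ ∑ i ∈ Finset.range m, b i)
    {φ : ℝ → ℝ} (hφ0 : ∀ t, 0 < t → 0 ≤ φ t) (hφ : ∀ t u, 0 < t → t ≤ u → φ u ≤ φ t) :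
    ∑ i ∈ Finset.range r, φ (s i) * (c i - d i) ≤ 0 := by
  cases r with
  | zero => simp
  | succ r =>
    refine (sum_mul_le_last_mul_sum (fun i => φ (s i)) _ r fun i hi => ?_).trans ?_
    · rcases hs.slope_eq_or_sum_eq i (by omega) with h | h
      · rw [h, sub_self, zero_mul]
      · refine mul_nonpos_of_nonneg_of_nonpos (sub_nonneg.2 ?_) ?_
        · exact hφ _ _ (hs.slope_pos _ (by omega)) (hs.slope_mono _ _ (by omega) (by omega))
        · rw [Finset.sum_sub_distrib, h, sub_nonpos]
          exact hc _ (by omega)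
    · refine mul_nonpos_of_nonneg_of_nonpos (hφ0 _ (hs.slope_pos _ (by omega))) ?_
      rw [Finset.sum_sub_distrib, hs.sum_eq, sub_nonpos]
      exact hc _ le_rfl

/-- Tangent line at `s * a` to the concave function `c ↦ a ^ p * c ^ q`. Because `p + q = 1`, its
slope does not involve `a`. The inequality is weighted AM-GM for `a` and `c / s`. -/
theorem rpow_mul_rpow_le_tangent {p q a c s : ℝ} (hp : 0 < p) (hq : 0 < q) (hpq : p + q = 1)
    (ha : 0 ≤ a) (hc : 0 ≤ c) (hs : 0 < s) :
    a ^ p * c ^ q ≤ a ^ p * (s * a) ^ q + q * s ^ (-p) * (c - s * a) := by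
  have h1 := Real.geom_mean_le_arith_mean2_weighted hp.le hq.le ha (div_nonneg hc hs.le) hpq
  have h2 : a ^ p * (s * a) ^ q = s ^ q * a := by
    rw [Real.mul_rpow hs.le ha, mul_left_comm, ← Real.rpow_add_of_nonneg ha hp.le hq.le, hpq,
      Real.rpow_one]
  have h3 : a ^ p * c ^ q = s ^ q * (a ^ p * (c / s) ^ q) := by
    rw [Real.div_rpow hc hs.le]
    have := (Real.rpow_pos_of_pos hs q).ne'
    field_simp
  have h4 : s ^ (-p) = s ^ q / s := by
    rw [show -p = q - 1 by linarith, Real.rpow_sub hs, Real.rpow_one]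
  have hsq := Real.rpow_pos_of_pos hs q
  rw [h2, h3, h4]
  refine (mul_le_mul_of_nonneg_left h1 hsq.le).trans (le_of_eq ?_)
  have : p = 1 - q := by linarith
  subst this
  field_simp
  ring

theorem mul_log_le_tangent {a c s : ℝ} (ha : 0 < a) (hc : 0 < c) (hs : 0 < s) :
    a * Real.log c ≤ a * Real.log (s * a) + s⁻¹ * (c - s * a) := by
  have hsa : 0 < s * a := mul_pos hs ha
  have h := Real.log_le_sub_one_of_pos (div_pos hc hsa)
  rw [Real.log_div hc.ne' hsa.ne'] at h
  have h2 := mul_le_mul_of_nonneg_left h ha.le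
  have h3 : a * (c / (s * a) - 1) = s⁻¹ * (c - s * a) := by
    field_simp
  linarith

theorem sum_univ_eq_sum_range_numPos {n : ℕ} {a c : Fin n → ℝ} (ha : Antitone a)
    (ha0 : ∀ i, 0 ≤ a i) {F : ℝ → ℝ → ℝ} (hF : ∀ t, F 0 t = 0) :
    ∑ i, F (a i) (c i) = ∑ i ∈ Finset.range (numPos a), F (extendZero a i) (extendZero c i) := by
  have e : ∑ i, F (a i) (c i) = ∑ i ∈ Finset.range n, F (extendZero a i) (extendZero c i) := by
    rw [← Fin.sum_univ_eq_sum_range (fun i => F (extendZero a i) (extendZero c i))]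
    simp only [extendZero_coe]
  rw [e]
  symm
  refine Finset.sum_subset (Finset.range_mono (numPos_le a)) fun i hi hi' => ?_
  rw [Finset.mem_range] at hi hi'
  rw [extendZero_of_lt a hi]
  have : a ⟨i, hi⟩ = 0 :=
    le_antisymm (not_lt.1 fun h => hi' ((lt_numPos_iff ha ⟨i, hi⟩).2 h)) (ha0 _)
  rw [this, hF]

theorem sum_rpow_mul_rpow_le_output {n : ℕ} {a b c : Fin n → ℝ} (ha : Antitone a)
    (ha0 : ∀ i, 0 ≤ a i) (hb : Antitone b) (hb0 : ∀ i, 0 ≤ b i) (hbs : 0 < ∑ i, b i)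
    (hc0 : ∀ i, 0 ≤ c i)
    (hcb : ∀ m ≤ n, (∑ i : Fin n, if i.val < m then c i else 0) ≤
      ∑ i : Fin n, if i.val < m then b i else 0)
    {p q : ℝ} (hp : 0 < p) (hq : 0 < q) (hpq : p + q = 1) :
    ∑ i, a i ^ p * c i ^ q ≤ ∑ i, a i ^ p * output a b i ^ q := by
  obtain ⟨s, hs⟩ := output_spec ha hb hb0 hbs
  have hF : ∀ t : ℝ, (0 : ℝ) ^ p * t ^ q = 0 := fun t => by rw [Real.zero_rpow hp.ne', zero_mul]
  rw [sum_univ_eq_sum_range_numPos (F := fun x y => x ^ p * y ^ q) ha ha0 hF,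
    sum_univ_eq_sum_range_numPos (F := fun x y => x ^ p * y ^ q) ha ha0 hF]
  have hrn := numPos_le a
  have key := hs.sum_mul_nonpos (c := extendZero c) (φ := fun t => q * t ^ (-p))
    (fun m hm => by
      rw [sum_range_extendZero c (hm.trans hrn), sum_range_extendZero b (hm.trans hrn)]
      exact hcb m (hm.trans hrn))
    (fun t ht => by positivity)
    (fun t u ht htu => mul_le_mul_of_nonneg_left
      (Real.rpow_le_rpow_of_nonpos ht htu (by linarith)) hq.le)
  refine le_trans (Finset.sum_le_sum fun i hi => ?_)
    (le_of_eq_of_le Finset.sum_add_distrib (add_le_of_nonpos_right key))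
  rw [Finset.mem_range] at hi
  rw [hs.eq_mul i hi, extendZero_of_lt a (by omega : i < n), extendZero_of_lt c (by omega : i < n)]
  exact rpow_mul_rpow_le_tangent hp hq hpq (ha0 _) (hc0 _) (hs.slope_pos i hi)

/-- An entry of `c` may vanish where `a` does not, and there `Real.log 0 = 0` would spoil the
tangent bound. The shift by `ε` avoids this at the cost `ε * ∑ 1 / s_i`, whose coefficient is
independent of `ε`. -/
theorem exists_sum_mul_log_le_output {n : ℕ} {a b c : Fin n → ℝ} (ha : Antitone a)
    (ha0 : ∀ i, 0 ≤ a i) (hb : Antitone b) (hb0 : ∀ i, 0 ≤ b i) (hbs : 0 < ∑ i, b i)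
    (hc0 : ∀ i, 0 ≤ c i)
    (hcb : ∀ m ≤ n, (∑ i : Fin n, if i.val < m then c i else 0) ≤
      ∑ i : Fin n, if i.val < m then b i else 0) :
    ∃ W : ℝ, ∀ ε, 0 < ε → ∑ i, a i * Real.log (c i + ε) ≤
      (∑ i, a i * Real.log (output a b i)) + ε * W := by
  obtain ⟨s, hs⟩ := output_spec ha hb hb0 hbs
  refine ⟨∑ i ∈ Finset.range (numPos a), (s i)⁻¹, fun ε hε => ?_⟩
  rw [sum_univ_eq_sum_range_numPos (F := fun x y => x * Real.log (y + ε)) ha ha0 (by simp),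
    sum_univ_eq_sum_range_numPos (F := fun x y => x * Real.log y) ha ha0 (by simp)]
  have hrn := numPos_le a
  have key := hs.sum_mul_nonpos (c := extendZero c) (φ := fun t => t⁻¹)
    (fun m hm => by
      rw [sum_range_extendZero c (hm.trans hrn), sum_range_extendZero b (hm.trans hrn)]
      exact hcb m (hm.trans hrn))
    (fun t ht => by positivity)
    (fun t u ht htu => inv_anti₀ ht htu)
  rw [Finset.mul_sum, ← Finset.sum_add_distrib]
  refine le_trans (Finset.sum_le_sum fun i hi => ?_)
    (le_of_eq_of_le Finset.sum_add_distrib (add_le_of_nonpos_right key))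
  rw [Finset.mem_range] at hi
  have hai : 0 < extendZero a i := by
    rw [extendZero_of_lt a (by omega : i < n)]
    exact (lt_numPos_iff ha _).1 hi
  have hci : 0 ≤ extendZero c i := by
    rw [extendZero_of_lt c (by omega : i < n)]
    exact hc0 _
  have := mul_log_le_tangent hai (by linarith : 0 < extendZero c i + ε) (hs.slope_pos i hi)
  rw [hs.eq_mul i hi]
  linarith

theorem output_pos {n : ℕ} {a b : Fin n → ℝ} (ha : Antitone a) (hb : Antitone b)
    (hb0 : ∀ i, 0 ≤ b i) (hbs : 0 < ∑ i, b i) {i : Fin n} (hi : 0 < a i) : 0 < output a b i := by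
  obtain ⟨s, hs⟩ := output_spec ha hb hb0 hbs
  have hir := (lt_numPos_iff ha i).2 hi
  rw [← extendZero_coe (output a b) i, hs.eq_mul i hir, extendZero_coe]
  exact mul_pos (hs.slope_pos i hir) hi

theorem partial_sum_output_le {n : ℕ} {a b : Fin n → ℝ} (ha : Antitone a) (hb : Antitone b)
    (hb0 : ∀ i, 0 ≤ b i) (hbs : 0 < ∑ i, b i) {m : ℕ} (hm : m ≤ n) :
    (∑ i : Fin n, if i.val < m then output a b i else 0) ≤
      ∑ i : Fin n, if i.val < m then b i else 0 := by
  obtain ⟨s, hs⟩ := output_spec ha hb hb0 hbs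
  rw [← sum_range_extendZero _ hm, ← sum_range_extendZero _ hm]
  exact hs.sum_le m

theorem sum_output {n : ℕ} {a b : Fin n → ℝ} (ha : Antitone a) (hb : Antitone b)
    (hb0 : ∀ i, 0 ≤ b i) (hbs : 0 < ∑ i, b i) : ∑ i, output a b i = ∑ i, b i := by
  obtain ⟨s, hs⟩ := output_spec ha hb hb0 hbs
  have e : ∀ x : Fin n → ℝ, ∑ i, x i = ∑ i ∈ Finset.range n, extendZero x i := by
    intro x
    rw [← Fin.sum_univ_eq_sum_range (extendZero x)]
    simp only [extendZero_coe]
  rw [e, e, ← Finset.sum_range_add_sum_Ico _ (numPos_le a), hs.sum_eq,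
    ← Finset.sum_range_add_sum_Ico _ (numPos_le a)]
  congr 1
  exact Finset.sum_congr rfl fun i hi => hs.eq_tail i (Finset.mem_Ico.1 hi).1

theorem output_nonneg {n : ℕ} {a b : Fin n → ℝ} (ha : Antitone a) (ha0 : ∀ i, 0 ≤ a i)
    (hb : Antitone b) (hb0 : ∀ i, 0 ≤ b i) (hbs : 0 < ∑ i, b i) (i : Fin n) : 0 ≤ output a b i := by
  obtain ⟨s, hs⟩ := output_spec ha hb hb0 hbs
  rw [← extendZero_coe (output a b) i]
  rcases lt_or_ge i.val (numPos a) with h | h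
  · rw [hs.eq_mul i h, extendZero_coe]
    exact mul_nonneg (hs.slope_pos i h).le (ha0 i)
  · rw [hs.eq_tail i h, extendZero_coe]
    exact hb0 i

end QOpt

/-! ### Diagonalization and functional calculus -/

namespace QOpt

variable {n : ℕ}

/-- The complex diagonal matrix with real diagonal `x`. -/
def realDiag (x : Fin n → ℝ) : Mat n := Matrix.diagonal fun i => (x i : ℂ)

theorem realDiag_mul (x y : Fin n → ℝ) : realDiag x * realDiag y = realDiag fun i => x i * y i := by
  simp [realDiag, Matrix.diagonal_mul_diagonal]

theorem conjTranspose_realDiag (x : Fin n → ℝ) : (realDiag x)ᴴ = realDiag x := by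
  rw [realDiag, Matrix.diagonal_conjTranspose]
  congr 1
  ext i
  simp

theorem trace_realDiag_re (x : Fin n → ℝ) : (realDiag x).trace.re = ∑ i, x i := by
  simp [realDiag, Matrix.trace_diagonal]

theorem conjTranspose_mul_self_of_mem {V : Mat n} (hV : V ∈ Matrix.unitaryGroup (Fin n) ℂ) :
    Vᴴ * V = 1 := Matrix.mem_unitaryGroup_iff'.1 hV

theorem mul_conjTranspose_self_of_mem {V : Mat n} (hV : V ∈ Matrix.unitaryGroup (Fin n) ℂ) :
    V * Vᴴ = 1 := Matrix.mem_unitaryGroup_iff.1 hV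

theorem eq_conj_of_diag {V A D : Mat n} (hV : V ∈ Matrix.unitaryGroup (Fin n) ℂ)
    (h : Vᴴ * A * V = D) : A = V * D * Vᴴ := by
  have h1 := mul_conjTranspose_self_of_mem hV
  calc A = (V * Vᴴ) * A * (V * Vᴴ) := by rw [h1, one_mul, mul_one]
    _ = V * D * Vᴴ := by rw [← h]; simp only [Matrix.mul_assoc]

/-- The spectrum is finite, so any `f`, continuous or not, may be replaced by an interpolating
polynomial, and polynomials commute with conjugation. -/
theorem cfc_conj_realDiag {V : Mat n} (hV : V ∈ Matrix.unitaryGroup (Fin n) ℂ) (f : ℝ → ℝ)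
    (x : Fin n → ℝ) :
    cfc f (V * realDiag x * Vᴴ) = V * realDiag (fun i => f (x i)) * Vᴴ := by
  set A := V * realDiag x * Vᴴ with hA
  have hV' := conjTranspose_mul_self_of_mem hV
  have hV'' := mul_conjTranspose_self_of_mem hV
  have hsa : IsSelfAdjoint A := by
    rw [isSelfAdjoint_iff, Matrix.star_eq_conjTranspose, hA]
    simp only [Matrix.conjTranspose_mul, Matrix.conjTranspose_conjTranspose,
      conjTranspose_realDiag, Matrix.mul_assoc]
  -- Interpolating on both sets avoids having to identify the spectrum with the range of `x`.
  have hfin : (spectrum ℝ A ∪ Set.range x).Finite :=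
    A.finite_real_spectrum.union (Set.finite_range x)
  set p : Polynomial ℝ := Lagrange.interpolate hfin.toFinset id f with hp
  have heval : ∀ t ∈ spectrum ℝ A ∪ Set.range x, p.eval t = f t := fun t ht =>
    Lagrange.eval_interpolate_at_node (v := id) f (Set.injOn_id _) (hfin.mem_toFinset.2 ht)
  have hpow : ∀ k : ℕ, A ^ k = V * realDiag (fun i => x i ^ k) * Vᴴ := by
    intro k
    induction k with
    | zero =>
      have h1 : realDiag (fun _ : Fin n => (1 : ℝ)) = 1 := by simp [realDiag]
      simp only [pow_zero]
      rw [h1, mul_one, hV'']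
    | succ k ih =>
      rw [pow_succ, ih, hA]
      calc V * realDiag (fun i => x i ^ k) * Vᴴ * (V * realDiag x * Vᴴ)
          = V * realDiag (fun i => x i ^ k) * (Vᴴ * V) * realDiag x * Vᴴ := by
            simp only [Matrix.mul_assoc]
        _ = V * (realDiag (fun i => x i ^ k) * realDiag x) * Vᴴ := by
            rw [hV', mul_one]; simp only [Matrix.mul_assoc]
        _ = _ := by rw [realDiag_mul]; simp only [pow_succ]
  have haeval : ∀ P : Polynomial ℝ,
      Polynomial.aeval A P = V * realDiag (fun i => P.eval (x i)) * Vᴴ := by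
    intro P
    induction P using Polynomial.induction_on' with
    | add P Q hP hQ =>
      rw [map_add, hP, hQ, ← add_mul, ← mul_add]
      congr 2
      simp only [realDiag, Matrix.diagonal_add, Polynomial.eval_add, Complex.ofReal_add]
    | monomial k c =>
      rw [Polynomial.aeval_monomial, hpow, ← Algebra.smul_def, ← smul_mul_assoc, ← mul_smul_comm]
      congr 2
      ext i j
      by_cases hij : i = j
      · subst hij
        simp [realDiag, Polynomial.eval_monomial]
      · simp [realDiag, hij]
  rw [← cfc_congr (fun t ht => heval t (Or.inl ht)), cfc_polynomial p A hsa, haeval]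
  congr 3
  ext i
  exact heval _ (Or.inr ⟨i, rfl⟩)

theorem submatrix_mem_unitaryGroup {V : Mat n} (hV : V ∈ Matrix.unitaryGroup (Fin n) ℂ)
    (π : Equiv.Perm (Fin n)) : V.submatrix id π ∈ Matrix.unitaryGroup (Fin n) ℂ := by
  rw [Matrix.mem_unitaryGroup_iff', Matrix.star_eq_conjTranspose, Matrix.conjTranspose_submatrix]
  rw [show Vᴴ.submatrix π id * V.submatrix id π = (Vᴴ * V).submatrix π π from
    (Matrix.submatrix_mul_equiv Vᴴ V π (Equiv.refl _) π)]
  rw [conjTranspose_mul_self_of_mem hV, Matrix.submatrix_one_equiv]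

theorem submatrix_conj_eq {V A : Mat n} {x : Fin n → ℝ} (h : Vᴴ * A * V = realDiag x)
    (π : Equiv.Perm (Fin n)) :
    (V.submatrix id π)ᴴ * A * V.submatrix id π = realDiag (x ∘ π) := by
  have h1 : (V.submatrix id π)ᴴ * A * V.submatrix id π = (Vᴴ * A * V).submatrix π π := by
    ext i j
    simp [Matrix.mul_apply]
  rw [h1, h, realDiag, Matrix.submatrix_diagonal_equiv]
  rfl

theorem exists_antitone_comp_perm (x : Fin n → ℝ) : ∃ π : Equiv.Perm (Fin n), Antitone (x ∘ π) := by
  refine ⟨Tuple.sort (fun i => -x i), fun i j hij => ?_⟩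
  have := Tuple.monotone_sort (fun i => -x i) hij
  simpa using this

theorem exists_sorted_diagonalization {A : Mat n} (hA : A.IsHermitian) :
    ∃ V ∈ Matrix.unitaryGroup (Fin n) ℂ, ∃ x : Fin n → ℝ, Antitone x ∧
      Vᴴ * A * V = realDiag x ∧
      A.charpoly.roots = Finset.univ.val.map (fun i => (x i : ℂ)) := by
  obtain ⟨π, hπ⟩ := exists_antitone_comp_perm hA.eigenvalues
  refine ⟨(hA.eigenvectorUnitary : Mat n).submatrix id π,
    submatrix_mem_unitaryGroup hA.eigenvectorUnitary.2 π, hA.eigenvalues ∘ π, hπ, ?_, ?_⟩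
  · apply submatrix_conj_eq
    have := hA.conjStarAlgAut_star_eigenvectorUnitary
    simpa [Unitary.conjStarAlgAut_apply, Matrix.star_eq_conjTranspose, realDiag,
      Function.comp_def] using this
  · rw [hA.roots_charpoly_eq_eigenvalues]
    conv_lhs => rw [← Multiset.map_univ_val_equiv π, Multiset.map_map]
    rfl

theorem eq_of_antitone_of_map_eq {x y : Fin n → ℝ} (hx : Antitone x) (hy : Antitone y)
    (h : (Finset.univ : Finset (Fin n)).val.map x = Finset.univ.val.map y) : x = y := by
  rw [Fin.univ_val_map, Fin.univ_val_map, Multiset.coe_eq_coe] at h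
  apply List.ofFn_injective
  refine h.eq_of_pairwise (le := (· ≥ ·)) (fun s t _ _ h1 h2 => le_antisymm h2 h1) ?_ ?_
  · exact List.pairwise_ofFn.2 fun i j hij => hx hij.le
  · exact List.pairwise_ofFn.2 fun i j hij => hy hij.le

theorem HasSortedEigenvalues.exists_diagonalization {A : Mat n} {a : Fin n → ℝ}
    (h : HasSortedEigenvalues A a) (hA : A.IsHermitian) :
    ∃ V ∈ Matrix.unitaryGroup (Fin n) ℂ, Vᴴ * A * V = realDiag a := by
  obtain ⟨V, hV, x, hx, hd, hroots⟩ := exists_sorted_diagonalization hA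
  have hxa : x = a := by
    refine eq_of_antitone_of_map_eq hx h.1 ?_
    apply Multiset.map_injective Complex.ofReal_injective
    rw [Multiset.map_map, Multiset.map_map]
    exact hroots.symm.trans h.2
  exact ⟨V, hV, hxa ▸ hd⟩

theorem nonneg_of_conj_eq_realDiag {A V : Mat n} {x : Fin n → ℝ} (hA : A.PosSemidef)
    (h : Vᴴ * A * V = realDiag x) (i : Fin n) : 0 ≤ x i := by
  have h1 := hA.conjTranspose_mul_mul_same V
  rw [h, realDiag, Matrix.posSemidef_diagonal_iff] at h1
  exact_mod_cast h1 i

theorem sum_eq_one_of_conj_eq_realDiag {A V : Mat n} {x : Fin n → ℝ}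
    (hV : V ∈ Matrix.unitaryGroup (Fin n) ℂ) (hA : A.trace = 1)
    (h : Vᴴ * A * V = realDiag x) : ∑ i, x i = 1 := by
  rw [← trace_realDiag_re, ← h, Matrix.trace_mul_cycle, mul_conjTranspose_self_of_mem hV, one_mul,
    hA, Complex.one_re]

/-! ### Overlap matrices and the trace norm -/

/-- The squared absolute values of the entries. -/
noncomputable def normSqEntries (M : Mat n) (i j : Fin n) : ℝ := ‖M i j‖ ^ 2

theorem ofReal_normSqEntries (M : Mat n) (i j : Fin n) :
    (normSqEntries M i j : ℂ) = M i j * star (M i j) := by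
  rw [normSqEntries, Complex.star_def, Complex.mul_conj, Complex.normSq_eq_norm_sq]

theorem mul_conjTranspose_self_apply (M : Mat n) (i : Fin n) :
    (M * Mᴴ) i i = ((∑ j, normSqEntries M i j : ℝ) : ℂ) := by
  rw [Matrix.mul_apply, Complex.ofReal_sum]
  exact Finset.sum_congr rfl fun j _ => (ofReal_normSqEntries M i j).symm

theorem conjTranspose_mul_self_apply (M : Mat n) (j : Fin n) :
    (Mᴴ * M) j j = ((∑ i, normSqEntries M i j : ℝ) : ℂ) := by
  rw [Matrix.mul_apply, Complex.ofReal_sum]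
  refine Finset.sum_congr rfl fun i _ => ?_
  rw [ofReal_normSqEntries, mul_comm]
  rfl

/-- For a partial isometry, `E = M * Mᴴ` is an orthogonal projection. The row sum is its diagonal
entry `t`, and `E = E * Eᴴ` gives `t ≥ t ^ 2`. -/
theorem sum_normSqEntries_row_le {M : Mat n} (hM : M * Mᴴ * M = M) (i : Fin n) :
    ∑ j, normSqEntries M i j ≤ 1 := by
  set E := M * Mᴴ with hE
  have hEE : E * Eᴴ = E := by
    rw [hE, Matrix.conjTranspose_mul, Matrix.conjTranspose_conjTranspose, ← Matrix.mul_assoc, ← hE, hM]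
  set t := ∑ j, normSqEntries M i j with ht
  have h1 : E i i = (t : ℂ) := mul_conjTranspose_self_apply M i
  have h2 : (E * Eᴴ) i i = _ := mul_conjTranspose_self_apply E i
  rw [hEE, h1] at h2
  have h3 : t = ∑ j, normSqEntries E i j := by exact_mod_cast h2
  have h4 : normSqEntries E i i ≤ ∑ j, normSqEntries E i j :=
    Finset.single_le_sum (f := fun j => normSqEntries E i j) (fun j _ => by unfold normSqEntries; positivity)
      (Finset.mem_univ i)
  have h5 : normSqEntries E i i = t ^ 2 := by
    rw [normSqEntries, h1, Complex.norm_real, Real.norm_eq_abs, sq_abs]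
  nlinarith

theorem normSqEntries_conjTranspose (M : Mat n) (i j : Fin n) :
    normSqEntries Mᴴ i j = normSqEntries M j i := by
  simp [normSqEntries]

theorem isSubstochastic_normSqEntries {M : Mat n} (hM : M * Mᴴ * M = M) :
    IsSubstochastic (normSqEntries M) where
  nonneg i j := by unfold normSqEntries; positivity
  row_le := sum_normSqEntries_row_le hM
  col_le j := by
    have hM' : Mᴴ * Mᴴᴴ * Mᴴ = Mᴴ := by
      conv_rhs => rw [← hM]
      simp only [Matrix.conjTranspose_mul, Matrix.conjTranspose_conjTranspose, Matrix.mul_assoc]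
    simpa only [normSqEntries_conjTranspose] using sum_normSqEntries_row_le hM' j

theorem sum_normSqEntries_row_of_mem {W : Mat n} (hW : W ∈ Matrix.unitaryGroup (Fin n) ℂ)
    (i : Fin n) : ∑ j, normSqEntries W i j = 1 := by
  have := mul_conjTranspose_self_apply W i
  rw [mul_conjTranspose_self_of_mem hW, Matrix.one_apply_eq] at this
  exact_mod_cast this.symm

theorem sum_normSqEntries_col_of_mem {W : Mat n} (hW : W ∈ Matrix.unitaryGroup (Fin n) ℂ)
    (j : Fin n) : ∑ i, normSqEntries W i j = 1 := by
  have := conjTranspose_mul_self_apply W j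
  rw [conjTranspose_mul_self_of_mem hW, Matrix.one_apply_eq] at this
  exact_mod_cast this.symm

theorem conjTranspose_mul_mem {U V : Mat n} (hU : U ∈ Matrix.unitaryGroup (Fin n) ℂ)
    (hV : V ∈ Matrix.unitaryGroup (Fin n) ℂ) : Uᴴ * V ∈ Matrix.unitaryGroup (Fin n) ℂ :=
  mul_mem (Unitary.star_mem hU) hV

theorem isSubstochastic_of_mem {W : Mat n} (hW : W ∈ Matrix.unitaryGroup (Fin n) ℂ) :
    IsSubstochastic (normSqEntries W) :=
  isSubstochastic_normSqEntries (by rw [mul_conjTranspose_self_of_mem hW, one_mul])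

theorem trace_realDiag_mul (x y : Fin n → ℝ) (M N : Mat n) :
    (realDiag x * M * realDiag y * N).trace = ∑ i, ∑ j, (x i : ℂ) * M i j * y j * N j i := by
  simp [realDiag, Matrix.trace, Matrix.mul_apply, Matrix.diagonal_apply]

theorem trace_conj_mul_conj (U V : Mat n) (x y : Fin n → ℝ) :
    ((U * realDiag x * Uᴴ) * (V * realDiag y * Vᴴ)).trace.re =
      ∑ i, ∑ j, x i * y j * normSqEntries (Uᴴ * V) i j := by
  have h : ((U * realDiag x * Uᴴ) * (V * realDiag y * Vᴴ)).trace =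
      (realDiag x * (Uᴴ * V) * realDiag y * (Uᴴ * V)ᴴ).trace := by
    rw [Matrix.conjTranspose_mul, Matrix.conjTranspose_conjTranspose]
    rw [show (U * realDiag x * Uᴴ) * (V * realDiag y * Vᴴ) =
      U * (realDiag x * Uᴴ * V * realDiag y * Vᴴ) by simp only [Matrix.mul_assoc], Matrix.trace_mul_comm]
    simp only [Matrix.mul_assoc]
  rw [h, trace_realDiag_mul, Complex.re_sum]
  refine Finset.sum_congr rfl fun i _ => ?_
  rw [Complex.re_sum]
  refine Finset.sum_congr rfl fun j _ => ?_
  rw [Matrix.conjTranspose_apply, show ((x i : ℂ) * (Uᴴ * V) i j * y j * star ((Uᴴ * V) i j)) =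
    (x i : ℂ) * y j * ((Uᴴ * V) i j * star ((Uᴴ * V) i j)) by ring, ← ofReal_normSqEntries]
  norm_cast

theorem posSemidef_conj_diag_nonneg {Z V : Mat n} {h : Fin n → ℝ}
    (hd : Vᴴ * (Zᴴ * Z) * V = realDiag h) (i : Fin n) : 0 ≤ h i :=
  nonneg_of_conj_eq_realDiag (Matrix.posSemidef_conjTranspose_mul_self Z) hd i

/-- Polar decomposition: `K` is `Z` times the pseudoinverse of `|Z|`. A partial isometry is enough
later, so it need not be extended to a unitary when `Z` is singular. -/
theorem exists_partialIsometry_trAbs (Z : Mat n) :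
    ∃ K : Mat n, K * Kᴴ * K = K ∧ trAbs Z = (Kᴴ * Z).trace.re := by
  obtain ⟨V, hV, h, -, hd, -⟩ := exists_sorted_diagonalization
    (Matrix.posSemidef_conjTranspose_mul_self Z).isHermitian
  have h0 := posSemidef_conj_diag_nonneg hd
  -- The convention `0⁻¹ = 0` makes this a pseudoinverse.
  set G : Mat n := realDiag (fun i => (Real.sqrt (h i))⁻¹) with hG
  have hV' := conjTranspose_mul_self_of_mem hV
  have hGG : G * G * realDiag h * G = G := by
    rw [hG, realDiag_mul, realDiag_mul, realDiag_mul]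
    congr 1
    ext i
    rcases (h0 i).eq_or_lt with h1 | h1
    · rw [← h1]; simp
    · have := Real.sqrt_pos.2 h1
      have h2 := Real.mul_self_sqrt (h0 i)
      field_simp
      nlinarith
  have hK : (Z * (V * G * Vᴴ))ᴴ = V * G * Vᴴ * Zᴴ := by
    simp only [Matrix.conjTranspose_mul, Matrix.conjTranspose_conjTranspose, hG,
      conjTranspose_realDiag, Matrix.mul_assoc]
  refine ⟨Z * (V * G * Vᴴ), ?_, ?_⟩
  · rw [hK]
    calc Z * (V * G * Vᴴ) * (V * G * Vᴴ * Zᴴ) * (Z * (V * G * Vᴴ))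
        = Z * V * G * (Vᴴ * V) * G * (Vᴴ * (Zᴴ * Z) * V) * G * Vᴴ := by
          simp only [Matrix.mul_assoc]
      _ = Z * V * (G * G * realDiag h * G) * Vᴴ := by
          rw [hV', hd, mul_one]; simp only [Matrix.mul_assoc]
      _ = _ := by rw [hGG]; simp only [Matrix.mul_assoc]
  · rw [hK, trAbs]
    conv_lhs => rw [eq_conj_of_diag hV hd, cfc_conj_realDiag hV, Matrix.trace_mul_cycle, hV', one_mul]
    have : (V * G * Vᴴ * Zᴴ * Z).trace = (G * realDiag h).trace := by
      rw [← hd, show V * G * Vᴴ * Zᴴ * Z = V * (G * Vᴴ * Zᴴ * Z) by simp only [Matrix.mul_assoc],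
        Matrix.trace_mul_comm]
      simp only [Matrix.mul_assoc]
    rw [this, hG, realDiag_mul, trace_realDiag_re, trace_realDiag_re]
    refine Finset.sum_congr rfl fun i _ => ?_
    rw [inv_mul_eq_div, Real.div_sqrt]

/-- Von Neumann's trace inequality for positive semidefinite matrices. -/
theorem trAbs_conj_mul_conj_le {U V : Mat n} (hU : U ∈ Matrix.unitaryGroup (Fin n) ℂ)
    (hV : V ∈ Matrix.unitaryGroup (Fin n) ℂ) {x y : Fin n → ℝ} (hx : Antitone x)
    (hy : Antitone y) (hx0 : ∀ i, 0 ≤ x i) (hy0 : ∀ i, 0 ≤ y i) :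
    trAbs ((U * realDiag x * Uᴴ) * (V * realDiag y * Vᴴ)) ≤ ∑ i, x i * y i := by
  obtain ⟨K, hK, hKt⟩ := exists_partialIsometry_trAbs ((U * realDiag x * Uᴴ) * (V * realDiag y * Vᴴ))
  set N := Uᴴ * K * V with hN
  have hNN : N * Nᴴ * N = N := by
    have h1 := mul_conjTranspose_self_of_mem hU
    have h2 := mul_conjTranspose_self_of_mem hV
    calc N * Nᴴ * N = Uᴴ * K * (V * Vᴴ) * Kᴴ * (U * Uᴴ) * K * V := by
          simp only [hN, Matrix.conjTranspose_mul, Matrix.conjTranspose_conjTranspose, Matrix.mul_assoc]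
      _ = Uᴴ * (K * Kᴴ * K) * V := by
          rw [h1, h2, mul_one, mul_one]; simp only [Matrix.mul_assoc]
      _ = N := by rw [hK]
  have htr : (Kᴴ * ((U * realDiag x * Uᴴ) * (V * realDiag y * Vᴴ))).trace =
      (realDiag x * (Uᴴ * V) * realDiag y * Nᴴ).trace := by
    rw [show Kᴴ * ((U * realDiag x * Uᴴ) * (V * realDiag y * Vᴴ)) =
      (Kᴴ * U) * (realDiag x * Uᴴ * V * realDiag y * Vᴴ) by simp only [Matrix.mul_assoc],
      Matrix.trace_mul_comm]
    simp only [hN, Matrix.conjTranspose_mul, Matrix.conjTranspose_conjTranspose, Matrix.mul_assoc]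
  have hS1 := isSubstochastic_of_mem (conjTranspose_mul_mem hU hV)
  have hS2 := isSubstochastic_normSqEntries hNN
  have e1 := hS1.sum_le hx hy (Or.inl ⟨hx0, hy0⟩)
  have e2 := hS2.sum_le hx hy (Or.inl ⟨hx0, hy0⟩)
  -- Each product of moduli is at most the mean of their squares, which splits the trace into two
  -- substochastic sums, each bounded by `∑ x_i y_i`.
  have e3 : trAbs ((U * realDiag x * Uᴴ) * (V * realDiag y * Vᴴ)) ≤
      ∑ i, ∑ j, (x i * y j * normSqEntries (Uᴴ * V) i j + x i * y j * normSqEntries N i j) / 2 := by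
    rw [hKt, htr, trace_realDiag_mul, Complex.re_sum]
    refine Finset.sum_le_sum fun i _ => ?_
    rw [Complex.re_sum]
    refine Finset.sum_le_sum fun j _ => ?_
    refine (Complex.re_le_norm _).trans ?_
    rw [Matrix.conjTranspose_apply, norm_mul, norm_mul, norm_mul, Complex.norm_real, Complex.norm_real,
      norm_star, Real.norm_of_nonneg (hx0 i), Real.norm_of_nonneg (hy0 j), normSqEntries, normSqEntries]
    have h1 : 0 ≤ x i * y j := mul_nonneg (hx0 i) (hy0 j)
    nlinarith [mul_nonneg h1 (sq_nonneg (‖(Uᴴ * V) i j‖ - ‖N i j‖))]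
  simp only [← Finset.sum_div, Finset.sum_add_distrib] at e3
  linarith

end QOpt

/-! ### Channels: action on spectra and construction of an optimal one -/

namespace QOpt

variable {n : ℕ}

theorem mixedUnitaryChannels_subset_unitalChannels :
    mixedUnitaryChannels n ⊆ unitalChannels n := by
  rintro Φ ⟨r, F, hF, hU⟩
  refine ⟨⟨r, F, hF⟩, ?_⟩
  refine (hF.1 1).trans ((Finset.sum_congr rfl fun j _ => ?_).trans hF.2)
  obtain ⟨c, U, hUm, hj⟩ := hU j
  rw [hj, mul_one, Matrix.conjTranspose_smul, Matrix.smul_mul, Matrix.smul_mul, Matrix.mul_smul,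
    Matrix.mul_smul, mul_conjTranspose_self_of_mem hUm, conjTranspose_mul_self_of_mem hUm, smul_comm]

theorem IsKraus.posSemidef_apply {r : ℕ} {Φ : Mat n →ₗ[ℂ] Mat n} {F : Fin r → Mat n}
    (hF : IsKraus Φ F) {A : Mat n} (hA : A.PosSemidef) : (Φ A).PosSemidef := by
  rw [hF.1]
  exact Matrix.posSemidef_sum _ fun j _ => hA.mul_mul_conjTranspose_same (F j)

theorem mul_realDiag_mul_conjTranspose_apply (M : Mat n) (b : Fin n → ℝ) (i : Fin n) :
    (M * realDiag b * Mᴴ) i i = ((∑ j, normSqEntries M i j * b j : ℝ) : ℂ) := by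
  rw [Matrix.mul_apply, Complex.ofReal_sum]
  refine Finset.sum_congr rfl fun j _ => ?_
  rw [realDiag, Matrix.mul_diagonal, Complex.ofReal_mul, ofReal_normSqEntries,
    Matrix.conjTranspose_apply]
  ring

/-- Unital channels act on spectra by doubly stochastic matrices. -/
theorem exists_doublyStochastic_of_unital {Φ : Mat n →ₗ[ℂ] Mat n} (hΦ : Φ ∈ unitalChannels n)
    {ρ U V : Mat n} {b c : Fin n → ℝ} (hU : U ∈ Matrix.unitaryGroup (Fin n) ℂ)
    (hV : V ∈ Matrix.unitaryGroup (Fin n) ℂ) (hb : Uᴴ * ρ * U = realDiag b)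
    (hc : Vᴴ * Φ ρ * V = realDiag c) :
    ∃ S : Fin n → Fin n → ℝ, IsSubstochastic S ∧ (∀ i, ∑ j, S i j = 1) ∧
      ∀ i, c i = ∑ j, S i j * b j := by
  obtain ⟨⟨r, F, hF⟩, h1⟩ := hΦ
  -- Row sums express unitality.
  have hrow : ∀ i, ∑ j, (∑ k, normSqEntries (Vᴴ * F k * U) i j) = 1 := by
    intro i
    have h : ∑ k, (Vᴴ * F k * U) * (Vᴴ * F k * U)ᴴ = 1 := by
      calc ∑ k, (Vᴴ * F k * U) * (Vᴴ * F k * U)ᴴ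
          = ∑ k, Vᴴ * (F k * (U * Uᴴ) * (F k)ᴴ) * V := by
            refine Finset.sum_congr rfl fun k _ => ?_
            simp only [Matrix.conjTranspose_mul, Matrix.conjTranspose_conjTranspose, Matrix.mul_assoc]
        _ = Vᴴ * Φ 1 * V := by
            rw [mul_conjTranspose_self_of_mem hU, hF.1, Finset.mul_sum, Finset.sum_mul]
        _ = 1 := by rw [h1, mul_one, conjTranspose_mul_self_of_mem hV]
    have h2 := congrFun (congrFun h i) i
    rw [Matrix.sum_apply, Matrix.one_apply_eq] at h2
    simp only [mul_conjTranspose_self_apply] at h2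
    rw [Finset.sum_comm]
    exact_mod_cast h2
  -- Column sums express trace preservation.
  have hcol : ∀ j, ∑ i, (∑ k, normSqEntries (Vᴴ * F k * U) i j) = 1 := by
    intro j
    have h : ∑ k, (Vᴴ * F k * U)ᴴ * (Vᴴ * F k * U) = 1 := by
      calc ∑ k, (Vᴴ * F k * U)ᴴ * (Vᴴ * F k * U)
          = ∑ k, Uᴴ * ((F k)ᴴ * (V * Vᴴ) * F k) * U := by
            refine Finset.sum_congr rfl fun k _ => ?_
            simp only [Matrix.conjTranspose_mul, Matrix.conjTranspose_conjTranspose, Matrix.mul_assoc]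
        _ = Uᴴ * (∑ k, (F k)ᴴ * F k) * U := by
            rw [mul_conjTranspose_self_of_mem hV, Finset.mul_sum, Finset.sum_mul]
            simp only [mul_one]
        _ = 1 := by rw [hF.2, mul_one, conjTranspose_mul_self_of_mem hU]
    have h2 := congrFun (congrFun h j) j
    rw [Matrix.sum_apply, Matrix.one_apply_eq] at h2
    simp only [conjTranspose_mul_self_apply] at h2
    rw [Finset.sum_comm]
    exact_mod_cast h2
  refine ⟨fun i j => ∑ k, normSqEntries (Vᴴ * F k * U) i j,
    ⟨fun i j => Finset.sum_nonneg fun k _ => by unfold normSqEntries; positivity,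
      fun i => (hrow i).le, fun j => (hcol j).le⟩, hrow, fun i => ?_⟩
  have h : Vᴴ * Φ ρ * V = ∑ k, (Vᴴ * F k * U) * realDiag b * (Vᴴ * F k * U)ᴴ := by
    rw [hF.1, eq_conj_of_diag hU hb, Finset.mul_sum, Finset.sum_mul]
    refine Finset.sum_congr rfl fun k _ => ?_
    simp only [Matrix.conjTranspose_mul, Matrix.conjTranspose_conjTranspose, Matrix.mul_assoc]
  have h2 := congrFun (congrFun (hc.symm.trans h) i) i
  rw [Matrix.sum_apply, realDiag, Matrix.diagonal_apply_eq] at h2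
  simp only [mul_realDiag_mul_conjTranspose_apply] at h2
  have h3 : c i = ∑ k, ∑ j, normSqEntries (Vᴴ * F k * U) i j * b j := by exact_mod_cast h2
  rw [h3, Finset.sum_comm]
  simp only [Finset.sum_mul]

/-- A decreasing vector majorized by `b` is a convex combination of permutations of `b`. -/
theorem mem_convexHull_perm_of_partial_sums_le {b d : Fin n → ℝ} (hd : Antitone d)
    (hdb : ∀ m ≤ n, (∑ i : Fin n, if i.val < m then d i else 0) ≤
      ∑ i : Fin n, if i.val < m then b i else 0)
    (hsum : ∑ i, d i = ∑ i, b i) :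
    d ∈ convexHull ℝ (Set.range fun π : Equiv.Perm (Fin n) => b ∘ π) := by
  by_contra hmem
  obtain ⟨f, u, hfu, hud⟩ := geometric_hahn_banach_closed_point (convex_convexHull ℝ _)
    ((Set.finite_range fun π : Equiv.Perm (Fin n) => b ∘ π).isClosed_convexHull ℝ) hmem
  set w : Fin n → ℝ := fun i => f fun j => if i = j then 1 else 0 with hw
  have hf : ∀ x, f x = ∑ i, x i * w i := fun x =>
    (f : (Fin n → ℝ) →ₗ[ℝ] ℝ).pi_apply_eq_sum_univ x
  -- Sorting the weights of the separating functional can only increase its value at the decreasing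
  -- `d`; with sorted weights, `b` scores at least as much as `d`. So the functional is at least as
  -- large at `b ∘ π⁻¹` as at `d`, against separation.
  obtain ⟨π, hπ⟩ := exists_antitone_comp_perm w
  have h1 : ∑ i, d i * w i ≤ ∑ i, d i * (w ∘ π) i := by
    have := (hd.monovary hπ).sum_mul_comp_perm_le_sum_mul (σ := π⁻¹)
    simpa using this
  have h2 : ∑ i, (w ∘ π) i * (d i - b i) ≤ 0 := by
    refine sum_mul_nonpos_of_antitone hπ (fun m hm => ?_) (Or.inr ?_)
    · refine le_of_eq_of_le ?_ (sub_nonpos.2 (hdb m hm))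
      rw [← Finset.sum_sub_distrib]
      refine Finset.sum_congr rfl fun i _ => ?_
      split_ifs <;> simp
    · rw [Finset.sum_sub_distrib, hsum, sub_self]
  have h3 : f (b ∘ ⇑π⁻¹) = ∑ i, b i * (w ∘ π) i := by
    rw [hf, ← Equiv.sum_comp π]
    simp
  have h4 := hfu (b ∘ ⇑π⁻¹) (subset_convexHull ℝ _ ⟨π⁻¹, rfl⟩)
  rw [h3] at h4
  rw [hf] at hud
  have h5 : ∑ i, (w ∘ π) i * (d i - b i) = ∑ i, d i * (w ∘ π) i - ∑ i, b i * (w ∘ π) i := by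
    rw [← Finset.sum_sub_distrib]
    exact Finset.sum_congr rfl fun i _ => by ring
  linarith

/-- The linear map with given Kraus operators. -/
def krausMap {r : ℕ} (F : Fin r → Mat n) : Mat n →ₗ[ℂ] Mat n :=
  ∑ j, LinearMap.mulRight ℂ (F j)ᴴ ∘ₗ LinearMap.mulLeft ℂ (F j)

theorem krausMap_apply {r : ℕ} (F : Fin r → Mat n) (X : Mat n) :
    krausMap F X = ∑ j, F j * X * (F j)ᴴ := by
  simp [krausMap, LinearMap.sum_apply]

/-- Each unitary carries the eigenbasis `W` of `ρ`, permuted by some `π`, onto `V`, so conjugation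
produces `b ∘ π` on the diagonal. Averaging with the convex weights gives `d`; the Kraus operators
carry their square roots. -/
theorem exists_mixedUnitary_of_partial_sums_le {ρ V W : Mat n} {b d : Fin n → ℝ}
    (hV : V ∈ Matrix.unitaryGroup (Fin n) ℂ) (hW : W ∈ Matrix.unitaryGroup (Fin n) ℂ)
    (hb : Wᴴ * ρ * W = realDiag b) (hd : Antitone d)
    (hdb : ∀ m ≤ n, (∑ i : Fin n, if i.val < m then d i else 0) ≤
      ∑ i : Fin n, if i.val < m then b i else 0)
    (hsum : ∑ i, d i = ∑ i, b i) :
    ∃ Φ ∈ mixedUnitaryChannels n, Vᴴ * Φ ρ * V = realDiag d := by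
  have hmem := mem_convexHull_perm_of_partial_sums_le hd hdb hsum
  obtain ⟨ι, _, w, z, hw0, hw1, hz, hwz⟩ := mem_convexHull_iff_exists_fintype.1 hmem
  choose π hπ using hz
  let e := (Fintype.equivFin ι).symm
  let U : ι → Mat n := fun i => V * (W.submatrix id (π i))ᴴ
  have hU : ∀ i, U i ∈ Matrix.unitaryGroup (Fin n) ℂ := fun i =>
    mul_mem hV (Unitary.star_mem (submatrix_mem_unitaryGroup hW (π i)))
  let F : Fin (Fintype.card ι) → Mat n := fun k => (Real.sqrt (w (e k)) : ℂ) • U (e k)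
  have hcc : ∀ k, star (Real.sqrt (w (e k)) : ℂ) * (Real.sqrt (w (e k)) : ℂ) = (w (e k) : ℂ) := by
    intro k
    rw [Complex.star_def, Complex.conj_ofReal, ← Complex.ofReal_mul, Real.mul_self_sqrt (hw0 _)]
  have hFF : ∑ k, (F k)ᴴ * F k = 1 := by
    have h : ∀ k, (F k)ᴴ * F k = (w (e k) : ℂ) • (1 : Mat n) := by
      intro k
      simp only [F]
      rw [Matrix.conjTranspose_smul, Matrix.smul_mul, Matrix.mul_smul, smul_smul,
        conjTranspose_mul_self_of_mem (hU _), hcc]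
    simp only [h]
    rw [← Finset.sum_smul, Equiv.sum_comp e (fun i => (w i : ℂ)), ← Complex.ofReal_sum, hw1,
      Complex.ofReal_one, one_smul]
  refine ⟨krausMap F, ⟨_, F, ⟨krausMap_apply F, hFF⟩, fun k => ⟨_, _, hU (e k), rfl⟩⟩, ?_⟩
  have hterm : ∀ k, Vᴴ * (F k * ρ * (F k)ᴴ) * V = (w (e k) : ℂ) • realDiag (z (e k)) := by
    intro k
    have h1 := submatrix_conj_eq hb (π (e k))
    rw [← hπ, ← h1, ← hcc]
    have hV' := conjTranspose_mul_self_of_mem hV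
    simp only [F, U, Matrix.conjTranspose_smul, Matrix.smul_mul, Matrix.mul_smul, smul_smul,
      Matrix.conjTranspose_mul, Matrix.conjTranspose_conjTranspose]
    rw [mul_comm (star _)]
    congr 1
    calc Vᴴ * (V * (W.submatrix id (π (e k)))ᴴ * ρ * (W.submatrix id (π (e k)) * Vᴴ)) * V
        = (Vᴴ * V) * ((W.submatrix id (π (e k)))ᴴ * ρ * W.submatrix id (π (e k))) * (Vᴴ * V) := by
          simp only [Matrix.mul_assoc]
      _ = _ := by rw [hV', one_mul, mul_one]
  rw [krausMap_apply, Finset.mul_sum, Finset.sum_mul, Finset.sum_congr rfl fun k _ => hterm k,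
    Equiv.sum_comp e (fun i => (w i : ℂ) • realDiag (z i)), ← hwz]
  ext i j
  rw [Matrix.sum_apply]
  by_cases hij : i = j
  · subst hij
    simp [realDiag]
  · simp [realDiag, hij]

/-! ### Bounds and values of the trace functionals -/

theorem trPow_conj_le {U V : Mat n} (hU : U ∈ Matrix.unitaryGroup (Fin n) ℂ)
    (hV : V ∈ Matrix.unitaryGroup (Fin n) ℂ) {x y : Fin n → ℝ} (hx : Antitone x)
    (hy : Antitone y) (hx0 : ∀ i, 0 ≤ x i) (hy0 : ∀ i, 0 ≤ y i) {p q : ℝ} (hp : 0 ≤ p)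
    (hq : 0 ≤ q) :
    trPow p q (U * realDiag x * Uᴴ) (V * realDiag y * Vᴴ) ≤ ∑ i, x i ^ p * y i ^ q := by
  rw [trPow, cfc_conj_realDiag hU, cfc_conj_realDiag hV, trace_conj_mul_conj]
  exact (isSubstochastic_of_mem (conjTranspose_mul_mem hU hV)).sum_le
    (fun i j hij => Real.rpow_le_rpow (hx0 j) (hx hij) hp)
    (fun i j hij => Real.rpow_le_rpow (hy0 j) (hy hij) hq)
    (Or.inl ⟨fun i => Real.rpow_nonneg (hx0 i) p, fun i => Real.rpow_nonneg (hy0 i) q⟩)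

theorem trAbsPow_conj_le {U V : Mat n} (hU : U ∈ Matrix.unitaryGroup (Fin n) ℂ)
    (hV : V ∈ Matrix.unitaryGroup (Fin n) ℂ) {x y : Fin n → ℝ} (hx : Antitone x)
    (hy : Antitone y) (hx0 : ∀ i, 0 ≤ x i) (hy0 : ∀ i, 0 ≤ y i) {p q : ℝ} (hp : 0 ≤ p)
    (hq : 0 ≤ q) :
    trAbsPow p q (U * realDiag x * Uᴴ) (V * realDiag y * Vᴴ) ≤ ∑ i, x i ^ p * y i ^ q := by
  rw [trAbsPow, cfc_conj_realDiag hU, cfc_conj_realDiag hV]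
  exact trAbs_conj_mul_conj_le hU hV
    (fun i j hij => Real.rpow_le_rpow (hx0 j) (hx hij) hp)
    (fun i j hij => Real.rpow_le_rpow (hy0 j) (hy hij) hq)
    (fun i => Real.rpow_nonneg (hx0 i) p) (fun i => Real.rpow_nonneg (hy0 i) q)

/-- If `y j = 0`, column `j` of `V` lies in the second kernel, hence in the first; its image under
the first matrix has `i`-th coordinate `x i * (Uᴴ * V) i j` in the basis `U`. -/
theorem mul_normSqEntries_eq_zero_of_ker_le {U V : Mat n} (hU : U ∈ Matrix.unitaryGroup (Fin n) ℂ)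
    (hV : V ∈ Matrix.unitaryGroup (Fin n) ℂ) {x y : Fin n → ℝ}
    (hker : ∀ v : Fin n → ℂ, (V * realDiag y * Vᴴ) *ᵥ v = 0 → (U * realDiag x * Uᴴ) *ᵥ v = 0)
    (i j : Fin n) (hj : y j = 0) : x i * normSqEntries (Uᴴ * V) i j = 0 := by
  have h1 : (V * realDiag y * Vᴴ) *ᵥ (V *ᵥ Pi.single j 1) = 0 := by
    rw [Matrix.mulVec_mulVec, Matrix.mul_assoc, conjTranspose_mul_self_of_mem hV, mul_one,
      ← Matrix.mulVec_mulVec, realDiag, Matrix.diagonal_mulVec_single, hj]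
    simp
  have h2 := congrArg (fun v => Uᴴ *ᵥ v) (hker _ h1)
  rw [Matrix.mulVec_mulVec, Matrix.mulVec_mulVec, Matrix.mulVec_zero] at h2
  rw [show Uᴴ * (U * realDiag x * Uᴴ) * V = (Uᴴ * U) * realDiag x * (Uᴴ * V) by
    simp only [Matrix.mul_assoc], conjTranspose_mul_self_of_mem hU, one_mul] at h2
  have h3 := congrFun h2 i
  rw [Matrix.mulVec_single_one, Matrix.col_apply, realDiag, Matrix.diagonal_mul] at h3
  rcases mul_eq_zero.1 h3 with h | h
  · rw [Complex.ofReal_eq_zero.1 h, zero_mul]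
  · rw [normSqEntries, h, norm_zero]
    ring

/-- Since `Real.log 0 = 0`, the sequence `Real.log (y j)` need not be decreasing, whereas `Real.log
(y j + ε)` is. Rearrangement is applied to the latter, and then `ε` tends to `0`. -/
theorem trLog_conj_le {U V : Mat n} (hU : U ∈ Matrix.unitaryGroup (Fin n) ℂ)
    (hV : V ∈ Matrix.unitaryGroup (Fin n) ℂ) {x y : Fin n → ℝ} (hx : Antitone x)
    (hy : Antitone y) (hx0 : ∀ i, 0 ≤ x i) (hy0 : ∀ i, 0 ≤ y i) {K W : ℝ}
    (h : ∀ ε, 0 < ε → ∑ i, x i * Real.log (y i + ε) ≤ K + ε * W) :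
    trLog (U * realDiag x * Uᴴ) (V * realDiag y * Vᴴ) ≤ (K : EReal) := by
  rw [trLog]
  split_ifs with hker
  · rw [EReal.coe_le_coe_iff, cfc_conj_realDiag hV, trace_conj_mul_conj]
    have hW := conjTranspose_mul_mem hU hV
    have key : ∀ ε, 0 < ε →
        ∑ i, ∑ j, x i * Real.log (y j) * normSqEntries (Uᴴ * V) i j ≤ K + ε * W := by
      intro ε hε
      have h1 := (isSubstochastic_of_mem hW).sum_le (y := fun j => Real.log (y j + ε)) hx
        (fun i j hij => Real.log_le_log (by linarith [hy0 j]) (by linarith [hy hij]))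
        (Or.inr ⟨sum_normSqEntries_row_of_mem hW, sum_normSqEntries_col_of_mem hW⟩)
      refine (Finset.sum_le_sum fun i _ => Finset.sum_le_sum fun j _ => ?_).trans (h1.trans (h ε hε))
      have hS : 0 ≤ x i * normSqEntries (Uᴴ * V) i j :=
        mul_nonneg (hx0 i) ((isSubstochastic_of_mem hW).nonneg i j)
      rw [mul_right_comm, mul_right_comm (x i) _ (normSqEntries _ _ _)]
      -- Where `y j = 0` the kernel condition removes the term, so the junk value of the logarithm
      -- is harmless.
      rcases (hy0 j).eq_or_lt with hj | hj
      · rw [mul_normSqEntries_eq_zero_of_ker_le hU hV hker i j hj.symm, zero_mul, zero_mul]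
      · exact mul_le_mul_of_nonneg_left (Real.log_le_log hj (by linarith)) hS
    refine le_of_tendsto_of_tendsto (b := nhdsWithin (0 : ℝ) (Set.Ioi 0)) tendsto_const_nhds
      (g := fun ε => K + ε * W) ?_ (Filter.eventually_of_mem self_mem_nhdsWithin key)
    have : Filter.Tendsto (fun ε : ℝ => K + ε * W) (nhds 0) (nhds (K + 0 * W)) :=
      (by fun_prop : Continuous fun ε : ℝ => K + ε * W).tendsto 0
    rw [zero_mul, add_zero] at this
    exact this.mono_left nhdsWithin_le_nhds
  · exact bot_le

theorem conj_realDiag_mul_conj_realDiag {V : Mat n} (hV : V ∈ Matrix.unitaryGroup (Fin n) ℂ) (x y : Fin n → ℝ) :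
    ((V * realDiag x * Vᴴ) * (V * realDiag y * Vᴴ)) = V * realDiag (fun i => x i * y i) * Vᴴ := by
  calc (V * realDiag x * Vᴴ) * (V * realDiag y * Vᴴ)
      = V * (realDiag x * (Vᴴ * V) * realDiag y) * Vᴴ := by simp only [Matrix.mul_assoc]
    _ = _ := by rw [conjTranspose_mul_self_of_mem hV, mul_one, realDiag_mul]

theorem trace_conj_realDiag_re {V : Mat n} (hV : V ∈ Matrix.unitaryGroup (Fin n) ℂ)
    (x : Fin n → ℝ) : (V * realDiag x * Vᴴ).trace.re = ∑ i, x i := by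
  rw [Matrix.trace_mul_cycle, conjTranspose_mul_self_of_mem hV, one_mul, trace_realDiag_re]

theorem trPow_of_simulDiag {ρ σ : Mat n} {a d : Fin n → ℝ} (h : SimulDiag ρ σ a d) (p q : ℝ) :
    trPow p q ρ σ = ∑ i, a i ^ p * d i ^ q := by
  obtain ⟨V, hV, h1, h2⟩ := h
  rw [eq_conj_of_diag hV h1, eq_conj_of_diag hV h2]
  change trPow p q (V * realDiag a * Vᴴ) (V * realDiag d * Vᴴ) = _
  rw [trPow, cfc_conj_realDiag hV, cfc_conj_realDiag hV, conj_realDiag_mul_conj_realDiag hV,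
    trace_conj_realDiag_re hV]

theorem trAbsPow_of_simulDiag {ρ σ : Mat n} {a d : Fin n → ℝ} (h : SimulDiag ρ σ a d)
    (ha0 : ∀ i, 0 ≤ a i) (hd0 : ∀ i, 0 ≤ d i) (p q : ℝ) :
    trAbsPow p q ρ σ = ∑ i, a i ^ p * d i ^ q := by
  obtain ⟨V, hV, h1, h2⟩ := h
  rw [eq_conj_of_diag hV h1, eq_conj_of_diag hV h2]
  change trAbsPow p q (V * realDiag a * Vᴴ) (V * realDiag d * Vᴴ) = _
  have hct : ∀ x : Fin n → ℝ, (V * realDiag x * Vᴴ)ᴴ = V * realDiag x * Vᴴ := by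
    intro x
    simp only [Matrix.conjTranspose_mul, Matrix.conjTranspose_conjTranspose, conjTranspose_realDiag,
      Matrix.mul_assoc]
  rw [trAbsPow, cfc_conj_realDiag hV, cfc_conj_realDiag hV, conj_realDiag_mul_conj_realDiag hV, trAbs, hct,
    conj_realDiag_mul_conj_realDiag hV, cfc_conj_realDiag hV, trace_conj_realDiag_re hV]
  refine Finset.sum_congr rfl fun i _ => Real.sqrt_mul_self ?_
  exact mul_nonneg (Real.rpow_nonneg (ha0 i) p) (Real.rpow_nonneg (hd0 i) q)

theorem sum_mul_elog {a d : Fin n → ℝ} (had : ∀ i, a i = 0 ∨ 0 < d i) :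
    ∑ i, ((a i : ℝ) : EReal) * elog (d i) = ((∑ i, a i * Real.log (d i) : ℝ) : EReal) := by
  have hcoe : ∀ s : Finset (Fin n), ((∑ i ∈ s, a i * Real.log (d i) : ℝ) : EReal) =
      ∑ i ∈ s, ((a i * Real.log (d i) : ℝ) : EReal) := by
    intro s
    induction s using Finset.cons_induction with
    | empty => simp
    | cons i s hi ih => rw [Finset.sum_cons, Finset.sum_cons, EReal.coe_add, ih]
  rw [hcoe]
  refine Finset.sum_congr rfl fun i _ => ?_
  rcases had i with h | h
  · simp [h]
  · rw [elog, ENNReal.log_ofReal_of_pos h, EReal.coe_mul]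

theorem trLog_of_simulDiag {ρ σ : Mat n} {a d : Fin n → ℝ} (h : SimulDiag ρ σ a d)
    (had : ∀ i, a i = 0 ∨ 0 < d i) :
    trLog ρ σ = ((∑ i, a i * Real.log (d i) : ℝ) : EReal) := by
  obtain ⟨V, hV, h1, h2⟩ := h
  rw [eq_conj_of_diag hV h1, eq_conj_of_diag hV h2]
  change trLog (V * realDiag a * Vᴴ) (V * realDiag d * Vᴴ) = _
  have hker : ∀ v : Fin n → ℂ, (V * realDiag d * Vᴴ) *ᵥ v = 0 →
      (V * realDiag a * Vᴴ) *ᵥ v = 0 := by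
    intro v hv
    have h3 := congrArg (fun v => Vᴴ *ᵥ v) hv
    rw [Matrix.mulVec_mulVec, Matrix.mulVec_zero, show Vᴴ * (V * realDiag d * Vᴴ) =
      (Vᴴ * V) * realDiag d * Vᴴ by simp only [Matrix.mul_assoc], conjTranspose_mul_self_of_mem hV,
      one_mul, ← Matrix.mulVec_mulVec] at h3
    have h4 : realDiag a *ᵥ (Vᴴ *ᵥ v) = 0 := by
      funext i
      have h5 := congrFun h3 i
      rw [realDiag, Matrix.mulVec_diagonal, Pi.zero_apply] at h5 ⊢
      rcases had i with h6 | h6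
      · rw [h6, Complex.ofReal_zero, zero_mul]
      · rw [(mul_eq_zero.1 h5).resolve_left (Complex.ofReal_ne_zero.2 h6.ne'), mul_zero]
    rw [Matrix.mul_assoc, ← Matrix.mulVec_mulVec, ← Matrix.mulVec_mulVec, h4, Matrix.mulVec_zero]
  rw [trLog, if_pos hker, cfc_conj_realDiag hV, conj_realDiag_mul_conj_realDiag hV, trace_conj_realDiag_re hV]

end QOpt

/-! ### The maximum over channels -/

theorem theorem3p3 {n : ℕ} (ρ₁ ρ₂ : QOpt.Mat n)
    (hρ₁ : QOpt.IsDensity ρ₁) (hρ₂ : QOpt.IsDensity ρ₂)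
    (a b d : Fin n → ℝ)
    (ha : QOpt.HasSortedEigenvalues ρ₁ a) (hb : QOpt.HasSortedEigenvalues ρ₂ b)
    (hd : d = QOpt.output a b)
    (S : Set (QOpt.Mat n →ₗ[ℂ] QOpt.Mat n))
    (hS : S = QOpt.mixedUnitaryChannels n ∨ S = QOpt.unitalChannels n) :
    Antitone d ∧
    (∃ Φ ∈ S, QOpt.SimulDiag ρ₁ (Φ ρ₂) a d) ∧
    (∀ p q : ℝ, 0 < p → 0 < q → p + q = 1 →
      (IsGreatest ((fun Φ => QOpt.trPow p q ρ₁ (Φ ρ₂)) '' S) (∑ j, a j ^ p * d j ^ q) ∧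
        ∀ Φ ∈ S, QOpt.SimulDiag ρ₁ (Φ ρ₂) a d →
          QOpt.trPow p q ρ₁ (Φ ρ₂) = ∑ j, a j ^ p * d j ^ q) ∧
      (IsGreatest ((fun Φ => QOpt.trAbsPow p q ρ₁ (Φ ρ₂)) '' S) (∑ j, a j ^ p * d j ^ q) ∧
        ∀ Φ ∈ S, QOpt.SimulDiag ρ₁ (Φ ρ₂) a d →
          QOpt.trAbsPow p q ρ₁ (Φ ρ₂) = ∑ j, a j ^ p * d j ^ q)) ∧
    (IsGreatest ((fun Φ => QOpt.trLog ρ₁ (Φ ρ₂)) '' S)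
        (∑ j, ((a j : ℝ) : EReal) * QOpt.elog (d j)) ∧
      ∀ Φ ∈ S, QOpt.SimulDiag ρ₁ (Φ ρ₂) a d →
        QOpt.trLog ρ₁ (Φ ρ₂) = ∑ j, ((a j : ℝ) : EReal) * QOpt.elog (d j)) := by
  subst hd
  obtain ⟨U, hU, hUa⟩ := ha.exists_diagonalization hρ₁.1.isHermitian
  obtain ⟨W, hW, hWb⟩ := hb.exists_diagonalization hρ₂.1.isHermitian
  have ha0 := QOpt.nonneg_of_conj_eq_realDiag hρ₁.1 hUa
  have hb0 := QOpt.nonneg_of_conj_eq_realDiag hρ₂.1 hWb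
  have hbs : 0 < ∑ i, b i := by
    rw [QOpt.sum_eq_one_of_conj_eq_realDiag hW hρ₂.2 hWb]
    exact one_pos
  have hanti := QOpt.antitone_output ha.1 hb.1 hb0 hbs
  have hd0 := QOpt.output_nonneg ha.1 ha0 hb.1 hb0 hbs
  have had : ∀ i, a i = 0 ∨ 0 < QOpt.output a b i := fun i =>
    (ha0 i).eq_or_lt.imp Eq.symm fun h => QOpt.output_pos ha.1 hb.1 hb0 hbs h
  -- Both choices of `S` lie between the two classes: attainment is shown in the smaller class,
  -- upper bounds in the larger.
  have hsub : QOpt.mixedUnitaryChannels n ⊆ S := by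
    rcases hS with rfl | rfl
    · exact le_rfl
    · exact QOpt.mixedUnitaryChannels_subset_unitalChannels
  have hsup : S ⊆ QOpt.unitalChannels n := by
    rcases hS with rfl | rfl
    · exact QOpt.mixedUnitaryChannels_subset_unitalChannels
    · exact le_rfl
  have hex : ∃ Φ ∈ S, QOpt.SimulDiag ρ₁ (Φ ρ₂) a (QOpt.output a b) := by
    obtain ⟨Φ, hΦ, hΦd⟩ := QOpt.exists_mixedUnitary_of_partial_sums_le hU hW hWb hanti
      (fun m hm => QOpt.partial_sum_output_le ha.1 hb.1 hb0 hbs hm)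
      (QOpt.sum_output ha.1 hb.1 hb0 hbs)
    exact ⟨Φ, hsub hΦ, U, hU, hUa, hΦd⟩
  have hspec : ∀ Φ ∈ S, ∃ V ∈ Matrix.unitaryGroup (Fin n) ℂ, ∃ c : Fin n → ℝ, Antitone c ∧
      (∀ i, 0 ≤ c i) ∧ Φ ρ₂ = V * QOpt.realDiag c * Vᴴ ∧
      ∀ m ≤ n, (∑ i : Fin n, if i.val < m then c i else 0) ≤
        ∑ i : Fin n, if i.val < m then b i else 0 := by
    intro Φ hΦ
    obtain ⟨r, F, hF⟩ := (hsup hΦ).1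
    have hpos := hF.posSemidef_apply hρ₂.1
    obtain ⟨V, hV, c, hc, hVc, -⟩ := QOpt.exists_sorted_diagonalization hpos.isHermitian
    obtain ⟨T, hT, -, hcT⟩ := QOpt.exists_doublyStochastic_of_unital (hsup hΦ) hW hV hWb hVc
    refine ⟨V, hV, c, hc, QOpt.nonneg_of_conj_eq_realDiag hpos hVc, QOpt.eq_conj_of_diag hV hVc,
      fun m hm => ?_⟩
    simp only [hcT]
    exact hT.partial_sum_le hb.1 (Or.inl hb0) hm
  have hρ₁eq := QOpt.eq_conj_of_diag hU hUa
  obtain ⟨Φ₀, hΦ₀, hΦ₀d⟩ := hex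
  refine ⟨hanti, ⟨Φ₀, hΦ₀, hΦ₀d⟩, fun p q hp hq hpq => ⟨⟨⟨⟨Φ₀, hΦ₀, ?_⟩, ?_⟩, ?_⟩, ⟨⟨Φ₀, hΦ₀, ?_⟩, ?_⟩, ?_⟩,
    ⟨⟨Φ₀, hΦ₀, ?_⟩, ?_⟩, ?_⟩
  · exact QOpt.trPow_of_simulDiag hΦ₀d p q
  · rintro _ ⟨Φ, hΦ, rfl⟩
    obtain ⟨V, hV, c, hc, hc0, hΦc, hcb⟩ := hspec Φ hΦ
    dsimp only
    rw [hρ₁eq, hΦc]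
    exact (QOpt.trPow_conj_le hU hV ha.1 hc ha0 hc0 hp.le hq.le).trans
      (QOpt.sum_rpow_mul_rpow_le_output ha.1 ha0 hb.1 hb0 hbs hc0 hcb hp hq hpq)
  · exact fun Φ _ h => QOpt.trPow_of_simulDiag h p q
  · exact QOpt.trAbsPow_of_simulDiag hΦ₀d ha0 hd0 p q
  · rintro _ ⟨Φ, hΦ, rfl⟩
    obtain ⟨V, hV, c, hc, hc0, hΦc, hcb⟩ := hspec Φ hΦ
    dsimp only
    rw [hρ₁eq, hΦc]
    exact (QOpt.trAbsPow_conj_le hU hV ha.1 hc ha0 hc0 hp.le hq.le).trans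
      (QOpt.sum_rpow_mul_rpow_le_output ha.1 ha0 hb.1 hb0 hbs hc0 hcb hp hq hpq)
  · exact fun Φ _ h => QOpt.trAbsPow_of_simulDiag h ha0 hd0 p q
  · dsimp only
    rw [QOpt.sum_mul_elog had]
    exact QOpt.trLog_of_simulDiag hΦ₀d had
  · rintro _ ⟨Φ, hΦ, rfl⟩
    obtain ⟨V, hV, c, hc, hc0, hΦc, hcb⟩ := hspec Φ hΦ
    obtain ⟨K, hK⟩ := QOpt.exists_sum_mul_log_le_output ha.1 ha0 hb.1 hb0 hbs hc0 hcb
    dsimp only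
    rw [QOpt.sum_mul_elog had, hρ₁eq, hΦc]
    exact QOpt.trLog_conj_le hU hV ha.1 hc ha0 hc0 hK
  · intro Φ _ h
    rw [QOpt.sum_mul_elog had]
    exact QOpt.trLog_of_simulDiag h had
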